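/- A (3-dimensional, compact) hyperbolic cone-manifold $M$ is a space obtained from finitely many non-degenerate compact hyperbolic tetrahedra by gluing them isometrically face-to-face (with the combinatorics of a finite simplicial complex) so that the resulting space is a topological 3-manifold. The cone angle at an edge is the sum of the dihedral angles at this edge, and the singular locus $\Sigma$ of $M$ is the union of the closed edges whose cone angle differs from $2\pi$. An infinitesimal deformation of $M$ is an assignment of velocities to the vertices of each of the tetrahedra such that, in the first order, common edges of different tetrahedra keep equal lengths and all cone angles stay constant. It is trivial if, up to adding a Killing field on each tetrahedron, it only displaces the vertices within $M$ by tangent vectors that are tangent to all singular edges through the vertex. $M$ is infinitesimally flexible if it has a non-trivial infinitesimal deformation. Theorem. There exists a compact infinitesimally flexible hyperbolic cone-manifold $M$, homeomorphic to the 3-dimensional sphere, whose singular locus is the 1-skeleton of an octahedron: there is a homeomorphism $h\colon M\to\mathbb S^3\subset\mathbb R^4$ that maps $\Sigma$ onto the radial projection to $\mathbb S^3$ of the 1-skeleton of the octahedron in $\mathbb R^3\times\{0\}$ with vertices $\pm e_1,\pm e_2,\pm e_3$. -/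

import Mathlib

namespace HypCone

/-! ### Hyperbolic 3-space (hyperboloid model) -/

/-- The ambient Minkowski space `ℝ^{1,3}`; coordinate `0` is the time coordinate. -/
abbrev E4 : Type := Fin 4 → ℝ

/-- The Minkowski scalar product. -/
def mink (x y : E4) : ℝ := -(x 0 * y 0) + x 1 * y 1 + x 2 * y 2 + x 3 * y 3

/-- Hyperbolic 3-space: the upper sheet of the hyperboloid `⟨x, x⟩ = -1`. -/
def hyp3 : Set E4 := {x | mink x x = -1 ∧ 0 < x 0}

/-- Tangent vectors of hyperbolic space at the point `p`. -/
def tangentAt (p : E4) : Set E4 := {q | mink p q = 0}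

/-- The hyperbolic distance, `cosh d(x, y) = -⟨x, y⟩`. -/
noncomputable def hdist (x y : E4) : ℝ := Real.arcosh (-mink x y)

/-- The Riemannian exponential map `exp_p(q)` of hyperbolic space, for `q` tangent at `p`
(for `q = 0` the second summand vanishes and the value is `p`). -/
noncomputable def hexp (p q : E4) : E4 :=
  Real.cosh (√(mink q q)) • p + (Real.sinh (√(mink q q)) / √(mink q q)) • q

/-- A Killing field of hyperbolic space: the restriction of a linear vector field that is
skew-symmetric for the Minkowski scalar product. -/
def IsKilling (κ : E4 →ₗ[ℝ] E4) : Prop :=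
  ∀ x y, mink (κ x) y + mink x (κ y) = 0

/-- The initial direction at `a` (a positive multiple of the initial velocity) of the geodesic
from `a` to `x`, for points `a ≠ x` of hyperbolic space. -/
def direction (a x : E4) : E4 := x + mink a x • a

/-- The component of `x` orthogonal to `u`. -/
noncomputable def orthTo (u x : E4) : E4 := x - (mink u x / mink u u) • u

/-- The (unoriented) angle between two tangent vectors at a common point. -/
noncomputable def tangentAngle (x y : E4) : ℝ :=
  Real.arccos (mink x y / (√(mink x x) * √(mink y y)))

/-- The dihedral angle at the edge `ab` of the hyperbolic tetrahedron `abcd`. -/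
noncomputable def dihedralAngle (a b c d : E4) : ℝ :=
  tangentAngle (orthTo (direction a b) (direction a c)) (orthTo (direction a b) (direction a d))

/-! ### Gluing hyperbolic tetrahedra -/

/-- A collection of hyperbolic tetrahedra glued isometrically face-to-face, with the combinatorics
of a finite simplicial complex on the vertex set `V`. The vertex `v` of the tetrahedron `s` is
placed at the point `pos s v` of hyperbolic space (only the values with `s ∈ tets` and `v ∈ s`
matter); edges belonging to two tetrahedra have the same length in both, so that common faces are
isometric. -/
structure Gluing (V : Type) [Fintype V] [DecidableEq V] where
  tets : Finset (Finset V)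
  card_tets : ∀ s ∈ tets, s.card = 4
  pos : Finset V → V → E4
  pos_mem : ∀ s ∈ tets, ∀ v ∈ s, pos s v ∈ hyp3
  nondegenerate : ∀ s ∈ tets, LinearIndependent ℝ (fun v : s => pos s v)
  isometric : ∀ s ∈ tets, ∀ t ∈ tets, ∀ v ∈ s ∩ t, ∀ w ∈ s ∩ t,
    hdist (pos s v) (pos s w) = hdist (pos t v) (pos t w)

/-- The cone angle at the edge `ab`, when the tetrahedra `tets` are placed by `pos`: the sum of the
dihedral angles at `ab` of all tetrahedra containing `ab`. (The factor `1/2` is there because each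
tetrahedron `{a, b, c, d}` occurs for the two orders of `c, d`.) -/
noncomputable def coneAngle {V : Type} [Fintype V] [DecidableEq V] (tets : Finset (Finset V))
    (pos : Finset V → V → E4) (a b : V) : ℝ :=
  ∑ c : V, ∑ d : V, if ({a, b, c, d} : Finset V) ∈ tets then
    (1 / 2 : ℝ) * dihedralAngle (pos {a, b, c, d} a) (pos {a, b, c, d} b)
      (pos {a, b, c, d} c) (pos {a, b, c, d} d)
  else 0

namespace Gluing

variable {V : Type} [Fintype V] [DecidableEq V]

/-- The underlying space of the gluing, in barycentric coordinates: the geometric realization of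
the simplicial complex. (The point of the tetrahedron `s` with barycentric coordinates `x` is the
central projection of `∑ v, x v • pos s v` to hyperbolic space.) -/
abbrev carrier (M : Gluing V) : Type :=
  {x : V → ℝ // (∀ v, 0 ≤ x v) ∧ ∑ v, x v = 1 ∧ ∃ s ∈ M.tets, ∀ v, v ∉ s → x v = 0}

/-- `ab` is an edge with cone angle different from `2π`. -/
def IsSingularEdge (M : Gluing V) (a b : V) : Prop :=
  a ≠ b ∧ (∃ s ∈ M.tets, a ∈ s ∧ b ∈ s) ∧ coneAngle M.tets M.pos a b ≠ 2 * Real.pi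

/-- The singular locus: the union of all closed edges with cone angle different from `2π`. -/
def singularLocus (M : Gluing V) : Set M.carrier :=
  {x | ∃ a b, M.IsSingularEdge a b ∧ ∀ v, v ≠ a → v ≠ b → x.1 v = 0}

/-- `g` is the isometry of hyperbolic space that glues the tetrahedron `s` to the tetrahedron `t`
along their common face: it matches the two copies of the common face, and puts `s` and `t` on
different sides of it. -/
def IsTransition (M : Gluing V) (s t : Finset V) (g : E4 →ₗ[ℝ] E4) : Prop :=
  (∀ x y, mink (g x) (g y) = mink x y) ∧
  (∀ v ∈ s ∩ t, g (M.pos s v) = M.pos t v) ∧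
  ∃ n : E4, (∀ v ∈ s ∩ t, mink n (M.pos t v) = 0) ∧
    (∀ v ∈ s \ t, mink n (g (M.pos s v)) < 0) ∧
    (∀ v ∈ t \ s, 0 < mink n (M.pos t v))

end Gluing

/-- A compact hyperbolic cone-manifold (with vertices): hyperbolic tetrahedra glued isometrically
face-to-face so that the resulting space is a (topological) 3-manifold. -/
structure ConeManifold (V : Type) [Fintype V] [DecidableEq V] extends Gluing V where
  manifold : Nonempty (ChartedSpace (EuclideanSpace ℝ (Fin 3)) toGluing.carrier)

namespace ConeManifold

variable {V : Type} [Fintype V] [DecidableEq V]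

/-- The vertices of the tetrahedra at time `t`, when the vertex `v` of `s` moves along the geodesic
with initial velocity `q s v`. -/
noncomputable def move (M : ConeManifold V) (q : Finset V → V → E4) (t : ℝ) :
    Finset V → V → E4 :=
  fun s v => hexp (M.pos s v) (t • q s v)

/-- An infinitesimal deformation of a cone-manifold (with constant cone angles): the tetrahedra are
deformed by moving their vertices with velocities `q s v` so that, in the first order,
the common edges of two tetrahedra keep equal lengths (the tetrahedra still fit together), and the
cone angles around all edges remain constant (so that in particular non-singular edges remain
non-singular). -/
structure IsInfinitesimalDeformation (M : ConeManifold V) (q : Finset V → V → E4) : Prop where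
  tangent : ∀ s ∈ M.tets, ∀ v ∈ s, q s v ∈ tangentAt (M.pos s v)
  isometric : ∀ s ∈ M.tets, ∀ s' ∈ M.tets, ∀ v ∈ s ∩ s', ∀ w ∈ s ∩ s',
    HasDerivAt (fun t => hdist (M.move q t s v) (M.move q t s w)
      - hdist (M.move q t s' v) (M.move q t s' w)) 0 0
  angles : ∀ a b : V, HasDerivAt (fun t => coneAngle M.tets (M.move q t) a b) 0 0

/-- An infinitesimal deformation is trivial if it does not change the cone-manifold, but only the
triangulation used to describe it: up to a Killing field `κ s` for each tetrahedron `s`, it is given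
by the displacement `w` of the vertices by a vector field on the cone-manifold that is tangent to
the singular locus. Here `w s v` is the displacement of the vertex `v` as seen in the tetrahedron
`s`; displacements seen in adjacent tetrahedra correspond to each other under the gluing, and a
vertex on a singular edge moves in the direction of this edge (hence a vertex of the singular locus
does not move). -/
def IsTrivialDeformation (M : ConeManifold V) (q : Finset V → V → E4) : Prop :=
  ∃ (κ : Finset V → (E4 →ₗ[ℝ] E4)) (w : Finset V → V → E4),
    (∀ s ∈ M.tets, IsKilling (κ s)) ∧
    (∀ s ∈ M.tets, ∀ v ∈ s, q s v = κ s (M.pos s v) + w s v) ∧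
    (∀ s ∈ M.tets, ∀ t ∈ M.tets, (s ∩ t).card = 3 → ∀ g, M.IsTransition s t g →
      ∀ v ∈ s ∩ t, g (w s v) = w t v) ∧
    (∀ s ∈ M.tets, ∀ v ∈ s, ∀ u ∈ s, M.IsSingularEdge v u →
      w s v ∈ Submodule.span ℝ {M.pos s v, M.pos s u})

/-- A cone-manifold is infinitesimally flexible if it has a non-trivial infinitesimal
deformation (preserving the cone angles in the first order). -/
def InfinitesimallyFlexible (M : ConeManifold V) : Prop :=
  ∃ q, M.IsInfinitesimalDeformation q ∧ ¬ M.IsTrivialDeformation q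

end ConeManifold

/-- The 1-skeleton of the octahedron with vertices `± e₀, ± e₁, ± e₂`, in the hyperplane `x₃ = 0`
of `ℝ⁴`: the union of the twelve segments joining two vertices on different coordinate axes. -/
noncomputable def octahedronSkeleton : Set (EuclideanSpace ℝ (Fin 4)) :=
  {x | ∃ i j : Fin 3, i ≠ j ∧ ∃ σ τ : ℝ, (σ = 1 ∨ σ = -1) ∧ (τ = 1 ∨ τ = -1) ∧
    x ∈ segment ℝ (EuclideanSpace.single i.castSucc σ) (EuclideanSpace.single j.castSucc τ)}

end HypCone

/-!
The flexible cone-manifold is the double of an infinitesimally flexible hyperbolic octahedron. Let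
`q` be velocities of the vertices of an octahedron that change its edge lengths only to the second
order, but are not the values of a Killing field. Flex one copy of the octahedron with velocities
`q` and the other one with velocities `-q`. The common edges keep equal lengths to the first order,
and the cone angle at an edge of the octahedron is `θ(t) + θ(-t)`, where `θ` is the dihedral angle
of the flexing octahedron; hence its derivative at `t = 0` vanishes (`hasDerivAt_coneAngle_edge`).

Each copy is subdivided by a center, from which the octahedron has to be visible. The tetrahedra of
the double then form the boundary complex of the four-dimensional cross-polytope, and radial
projection is a homeomorphism with the sphere that takes the edges of the octahedron to the right
place (`CrossSpace.mem_skeleton_iff`). The cone angles at the edges that end at a center are `2π`,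
also during the deformation, as the octahedron remains star-shaped
(`IsStar.sum_dihedralAngle`). The cone angles at the edges of the octahedron are twice its dihedral
angles, and none of these is `π`; for the octahedron used here this follows from the signs of
finitely many rational numbers (`acute_or_obtuse`).

An octahedron is infinitesimally flexible if the planes of four of its faces, no two of which share
an edge, have a common point. This is the case for the bipyramid over a planar non-convex
quadrilateral whose axis meets the line through the two intersection points of opposite sides of the
quadrilateral. In the projective model of hyperbolic space, the bipyramid is star-shaped with
respect to the point of intersection of the axis with the plane of the quadrilateral. `octa` is such
a bipyramid with rational vertices, and `flex` its infinitesimal flex.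

In a trivial deformation, the vertices of the octahedron do not move relative to the Killing fields
of the tetrahedra, because they lie on singular edges of different directions. The Killing fields of
two tetrahedra of the same copy that share a face therefore agree on this face, and so they
coincide; but `flex` changes the length of the axis of the bipyramid
(`not_isTrivialDeformation_oppositeFlex`).
-/

namespace HypCone

open Filter Topology

/-! ### The Minkowski scalar product -/

theorem mink_comm (x y : E4) : mink x y = mink y x := by
  simp only [mink]; ring

theorem mink_add_left (x y z : E4) : mink (x + y) z = mink x z + mink y z := by
  simp only [mink, Pi.add_apply]; ring

theorem mink_smul_left (r : ℝ) (x y : E4) : mink (r • x) y = r * mink x y := by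
  simp only [mink, Pi.smul_apply, smul_eq_mul]; ring

theorem mink_sub_left (x y z : E4) : mink (x - y) z = mink x z - mink y z := by
  simp only [mink, Pi.sub_apply]; ring

theorem mink_add_right (x y z : E4) : mink x (y + z) = mink x y + mink x z := by
  simp only [mink, Pi.add_apply]; ring

theorem mink_smul_right (r : ℝ) (x y : E4) : mink x (r • y) = r * mink x y := by
  simp only [mink, Pi.smul_apply, smul_eq_mul]; ring

theorem mink_sub_right (x y z : E4) : mink x (y - z) = mink x y - mink x z := by
  simp only [mink, Pi.sub_apply]; ring

/-- The tangent spaces of hyperbolic space are positive definite. -/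
theorem mink_self_pos {a x : E4} (ha : mink a a = -1) (h : mink a x = 0) (hx : x ≠ 0) :
    0 < mink x x := by
  by_contra hneg
  apply hx
  simp only [mink] at ha h hneg
  -- Cauchy–Schwarz for the spatial parts of `a` and `x`
  have hcs : (a 1 * x 1 + a 2 * x 2 + a 3 * x 3) ^ 2 ≤
      (a 1 ^ 2 + a 2 ^ 2 + a 3 ^ 2) * (x 1 ^ 2 + x 2 ^ 2 + x 3 ^ 2) := by
    nlinarith [sq_nonneg (a 1 * x 2 - a 2 * x 1), sq_nonneg (a 1 * x 3 - a 3 * x 1),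
      sq_nonneg (a 2 * x 3 - a 3 * x 2)]
  have h1 : a 1 * x 1 + a 2 * x 2 + a 3 * x 3 = a 0 * x 0 := by linarith
  have h2 : a 1 ^ 2 + a 2 ^ 2 + a 3 ^ 2 = a 0 ^ 2 - 1 := by linarith
  rw [h1, h2] at hcs
  have h3 : (a 0 ^ 2 - 1) * (x 1 ^ 2 + x 2 ^ 2 + x 3 ^ 2) ≤ (a 0 ^ 2 - 1) * x 0 ^ 2 := by
    apply mul_le_mul_of_nonneg_left
    · linarith
    · rw [← h2]; positivity
  have h0 : x 0 = 0 := by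
    have : x 0 ^ 2 ≤ 0 := by nlinarith
    exact pow_eq_zero_iff two_ne_zero |>.1 (le_antisymm this (sq_nonneg _))
  have hs : x 1 ^ 2 + x 2 ^ 2 + x 3 ^ 2 ≤ 0 := by rw [h0] at hneg; linarith
  have e1 : x 1 = 0 := by
    apply pow_eq_zero_iff two_ne_zero |>.1
    nlinarith [sq_nonneg (x 1), sq_nonneg (x 2), sq_nonneg (x 3)]
  have e2 : x 2 = 0 := by
    apply pow_eq_zero_iff two_ne_zero |>.1
    nlinarith [sq_nonneg (x 1), sq_nonneg (x 2), sq_nonneg (x 3)]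
  have e3 : x 3 = 0 := by
    apply pow_eq_zero_iff two_ne_zero |>.1
    nlinarith [sq_nonneg (x 1), sq_nonneg (x 2), sq_nonneg (x 3)]
  ext i; fin_cases i <;> simp [h0, e1, e2, e3]

/-- The strict Cauchy–Schwarz inequality in the tangent space of hyperbolic space at `a`. -/
theorem mink_sq_lt {a x y : E4} (ha : mink a a = -1) (hx : mink a x = 0) (hy : mink a y = 0)
    (hx0 : x ≠ 0) (hind : ∀ r : ℝ, y - r • x ≠ 0) :
    mink x y ^ 2 < mink x x * mink y y := by
  have hxx := mink_self_pos ha hx hx0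
  set r := mink x y / mink x x with hr
  have hz : mink a (y - r • x) = 0 := by rw [mink_sub_right, mink_smul_right, hx, hy]; simp
  have := mink_self_pos ha hz (hind r)
  rw [mink_sub_left, mink_sub_right, mink_sub_right, mink_smul_left, mink_smul_left,
    mink_smul_right, mink_smul_right, mink_comm y x] at this
  have hrx : r * mink x x = mink x y := by rw [hr]; field_simp
  rw [hrx] at this
  have : 0 < mink x x * (mink y y - r * mink x y) := mul_pos hxx (by linarith)
  have h2 : mink x x * (r * mink x y) = mink x y ^ 2 := by
    rw [← mul_assoc, mul_comm (mink x x), hrx]; ring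
  nlinarith

/-- A vector orthogonal to a basis of Minkowski space vanishes. -/
theorem eq_zero_of_mink_basis {x : Fin 4 → E4} (hx : LinearIndependent ℝ x) {y : E4}
    (h : ∀ i, mink y (x i) = 0) : y = 0 := by
  have hspan := hx.span_eq_top_of_card_eq_finrank (by simp)
  have key : ∀ z : E4, mink y z = 0 := by
    intro z
    have hz : z ∈ Submodule.span ℝ (Set.range x) := by rw [hspan]; trivial
    induction hz using Submodule.span_induction with
    | mem z hz => obtain ⟨i, rfl⟩ := hz; exact h i
    | zero => simp [mink]
    | add a b _ _ ha hb => rw [mink_add_right, ha, hb, add_zero]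
    | smul r a _ ha => rw [mink_smul_right, ha, mul_zero]
  ext i
  have := key (Pi.single i 1)
  fin_cases i <;> simpa [mink] using this

/-- A Killing field that vanishes at three independent points vanishes at every fourth point
independent of these. -/
theorem IsKilling.eq_zero_of_three {κ : E4 →ₗ[ℝ] E4} (hκ : IsKilling κ) {x : Fin 4 → E4}
    (hx : LinearIndependent ℝ x) (h : ∀ i, i ≠ 0 → κ (x i) = 0) : κ (x 0) = 0 := by
  apply eq_zero_of_mink_basis hx
  intro i
  have h1 := hκ (x 0) (x i)
  by_cases hi : i = 0
  · subst hi
    rw [mink_comm (x 0)] at h1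
    linarith
  · rw [h i hi] at h1
    have : mink (x 0) 0 = 0 := by simp [mink]
    linarith

theorem IsKilling.sub {κ κ' : E4 →ₗ[ℝ] E4} (hκ : IsKilling κ) (hκ' : IsKilling κ') :
    IsKilling (κ - κ') := by
  intro x y
  have h1 := hκ x y
  have h2 := hκ' x y
  rw [LinearMap.sub_apply, LinearMap.sub_apply, mink_sub_left, mink_sub_right]
  linarith

/-- A tangent vector at `p` that lies in two different planes through `0` and `p` vanishes. -/
theorem eq_zero_of_mem_span_pair {p u v w : E4}
    (hind : LinearIndependent ℝ ![p, u, v]) (hp : mink p p = -1) (hw : mink w p = 0)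
    (hu : w ∈ Submodule.span ℝ {p, u}) (hv : w ∈ Submodule.span ℝ {p, v}) : w = 0 := by
  obtain ⟨a, b, rfl⟩ := Submodule.mem_span_pair.1 hu
  obtain ⟨c, d, hcd⟩ := Submodule.mem_span_pair.1 hv
  have hb : b = 0 := by
    have := Fintype.linearIndependent_iff.1 hind ![a - c, b, -d] (by
      simp only [Fin.sum_univ_three, Matrix.cons_val]
      rw [sub_smul, neg_smul, eq_sub_of_add_eq hcd]; abel) 1
    simpa using this
  subst hb
  rw [zero_smul, add_zero, mink_smul_left, hp] at hw
  have : a = 0 := by linarith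
  simp [this]

/-! ### Differentiation along curves of points -/

theorem hasDerivAt_mink {x y : ℝ → E4} {x' y' : E4} {t : ℝ} (hx : HasDerivAt x x' t)
    (hy : HasDerivAt y y' t) :
    HasDerivAt (fun s => mink (x s) (y s)) (mink x' (y t) + mink (x t) y') t := by
  rw [hasDerivAt_pi] at hx hy
  have := ((((hx 0).mul (hy 0)).neg.add ((hx 1).mul (hy 1))).add ((hx 2).mul (hy 2))).add
    ((hx 3).mul (hy 3))
  refine HasDerivAt.congr_deriv this ?_
  simp only [mink]; ring

theorem differentiableAt_mink {x y : ℝ → E4} {t : ℝ} (hx : DifferentiableAt ℝ x t)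
    (hy : DifferentiableAt ℝ y t) : DifferentiableAt ℝ (fun s => mink (x s) (y s)) t :=
  (hasDerivAt_mink hx.hasDerivAt hy.hasDerivAt).differentiableAt

theorem differentiableAt_direction {x y : ℝ → E4} {t : ℝ} (hx : DifferentiableAt ℝ x t)
    (hy : DifferentiableAt ℝ y t) : DifferentiableAt ℝ (fun s => direction (x s) (y s)) t :=
  hy.add ((differentiableAt_mink hx hy).smul hx)

theorem differentiableAt_orthTo {x y : ℝ → E4} {t : ℝ} (hx : DifferentiableAt ℝ x t)
    (hy : DifferentiableAt ℝ y t) (h : mink (x t) (x t) ≠ 0) :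
    DifferentiableAt ℝ (fun s => orthTo (x s) (y s)) t :=
  hy.sub (((differentiableAt_mink hx hy).div (differentiableAt_mink hx hx) h).smul hx)

theorem differentiableAt_tangentAngle {x y : ℝ → E4} {t : ℝ} (hx : DifferentiableAt ℝ x t)
    (hy : DifferentiableAt ℝ y t) (hxx : 0 < mink (x t) (x t)) (hyy : 0 < mink (y t) (y t))
    (hlt : mink (x t) (y t) ^ 2 < mink (x t) (x t) * mink (y t) (y t)) :
    DifferentiableAt ℝ (fun s => tangentAngle (x s) (y s)) t := by
  have hpos : 0 < √(mink (x t) (x t)) * √(mink (y t) (y t)) := by positivity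
  have hd : DifferentiableAt ℝ
      (fun s => mink (x s) (y s) / (√(mink (x s) (x s)) * √(mink (y s) (y s)))) t :=
    (differentiableAt_mink hx hy).div
      (((differentiableAt_mink hx hx).sqrt hxx.ne').mul ((differentiableAt_mink hy hy).sqrt hyy.ne'))
      hpos.ne'
  have hlt1 : (mink (x t) (y t) / (√(mink (x t) (x t)) * √(mink (y t) (y t)))) ^ 2 < 1 := by
    rw [div_pow, mul_pow, Real.sq_sqrt hxx.le, Real.sq_sqrt hyy.le, div_lt_one (by positivity)]
    exact hlt
  rw [sq_lt_one_iff_abs_lt_one, abs_lt] at hlt1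
  exact (Real.differentiableAt_arccos.2 ⟨hlt1.1.ne', hlt1.2.ne⟩).comp t hd

theorem mink_direction {a : E4} (ha : mink a a = -1) (x : E4) : mink a (direction a x) = 0 := by
  rw [direction, mink_add_right, mink_smul_right, ha]; ring

theorem mink_orthTo {a u x : E4} (hu : mink a u = 0) (hx : mink a x = 0) :
    mink a (orthTo u x) = 0 := by
  rw [orthTo, mink_sub_right, mink_smul_right, hx, hu]; ring

/-- In a non-degenerate tetrahedron the edge vector, and the components of the other two edges
orthogonal to it, are non-zero, and these components are not parallel. -/
theorem dihedral_pos {a b c d : E4} (haa : mink a a = -1)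
    (hind : LinearIndependent ℝ ![a, b, c, d]) :
    0 < mink (direction a b) (direction a b) ∧
    0 < mink (orthTo (direction a b) (direction a c)) (orthTo (direction a b) (direction a c)) ∧
    0 < mink (orthTo (direction a b) (direction a d)) (orthTo (direction a b) (direction a d)) ∧
    mink (orthTo (direction a b) (direction a c)) (orthTo (direction a b) (direction a d)) ^ 2 <
      mink (orthTo (direction a b) (direction a c)) (orthTo (direction a b) (direction a c)) *
      mink (orthTo (direction a b) (direction a d)) (orthTo (direction a b) (direction a d)) := by
  have hlin : ∀ w x y z : ℝ, w • a + x • b + y • c + z • d = 0 → x = 0 ∧ y = 0 ∧ z = 0 := by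
    intro w x y z h
    have := Fintype.linearIndependent_iff.1 hind ![w, x, y, z]
      (by simpa only [Fin.sum_univ_four, Matrix.cons_val] using h)
    exact ⟨by simpa using this 1, by simpa using this 2, by simpa using this 3⟩
  have hu : 0 < mink (direction a b) (direction a b) := by
    refine mink_self_pos haa (mink_direction haa _) fun h => ?_
    have := hlin (mink a b) 1 0 0 (by rw [← h, direction]; module)
    exact one_ne_zero this.1
  have hC : mink a (orthTo (direction a b) (direction a c)) = 0 :=
    mink_orthTo (mink_direction haa _) (mink_direction haa _)
  have hD : mink a (orthTo (direction a b) (direction a d)) = 0 :=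
    mink_orthTo (mink_direction haa _) (mink_direction haa _)
  have hC0 : orthTo (direction a b) (direction a c) ≠ 0 := by
    intro h
    simp only [orthTo] at h
    set r := mink (direction a b) (direction a c) / mink (direction a b) (direction a b)
    have := hlin (mink a c - r * mink a b) (-r) 1 0
      (by rw [← h, direction, direction]; module)
    exact one_ne_zero this.2.1
  have hDC : ∀ s : ℝ, orthTo (direction a b) (direction a d) -
      s • orthTo (direction a b) (direction a c) ≠ 0 := by
    intro s h
    simp only [orthTo] at h
    set r := mink (direction a b) (direction a c) / mink (direction a b) (direction a b)
    set r' := mink (direction a b) (direction a d) / mink (direction a b) (direction a b)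
    have := hlin (mink a d - r' * mink a b - s * (mink a c - r * mink a b)) (-r' + s * r) (-s) 1
      (by rw [← h, direction, direction, direction]; module)
    exact one_ne_zero this.2.2
  exact ⟨hu, mink_self_pos haa hC hC0, mink_self_pos haa hD (by simpa using hDC 0),
    mink_sq_lt haa hC hD hC0 hDC⟩

/-- The dihedral angle depends differentiably on the vertices of a non-degenerate tetrahedron. -/
theorem differentiableAt_dihedralAngle {a b c d : ℝ → E4} {t : ℝ} (ha : DifferentiableAt ℝ a t)
    (hb : DifferentiableAt ℝ b t) (hc : DifferentiableAt ℝ c t) (hd : DifferentiableAt ℝ d t)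
    (haa : mink (a t) (a t) = -1) (hind : LinearIndependent ℝ ![a t, b t, c t, d t]) :
    DifferentiableAt ℝ (fun s => dihedralAngle (a s) (b s) (c s) (d s)) t := by
  obtain ⟨hu, hC, hD, hlt⟩ := dihedral_pos haa hind
  have hU := differentiableAt_direction ha hb
  exact differentiableAt_tangentAngle
    (differentiableAt_orthTo hU (differentiableAt_direction ha hc) hu.ne')
    (differentiableAt_orthTo hU (differentiableAt_direction ha hd) hu.ne') hC hD hlt

theorem dihedralAngle_lt_pi_div_two {a b c d : E4} (haa : mink a a = -1)
    (hind : LinearIndependent ℝ ![a, b, c, d])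
    (h : 0 < mink (orthTo (direction a b) (direction a c))
      (orthTo (direction a b) (direction a d))) : dihedralAngle a b c d < Real.pi / 2 := by
  obtain ⟨-, hC, hD, -⟩ := dihedral_pos haa hind
  exact Real.arccos_lt_pi_div_two.2
    (div_pos h (mul_pos (Real.sqrt_pos.2 hC) (Real.sqrt_pos.2 hD)))

theorem pi_div_two_lt_dihedralAngle {a b c d : E4} (haa : mink a a = -1)
    (hind : LinearIndependent ℝ ![a, b, c, d])
    (h : mink (orthTo (direction a b) (direction a c))
      (orthTo (direction a b) (direction a d)) < 0) : Real.pi / 2 < dihedralAngle a b c d := by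
  obtain ⟨-, hC, hD, -⟩ := dihedral_pos haa hind
  refine not_le.1 fun hle => (div_neg_of_neg_of_pos h
    (mul_pos (Real.sqrt_pos.2 hC) (Real.sqrt_pos.2 hD))).not_ge ?_
  exact Real.arccos_le_pi_div_two.1 hle

/-- The exponential map along a line, without the case distinction implicit in `√(t ^ 2) = |t|`. -/
theorem hexp_smul (p q : E4) (t : ℝ) :
    hexp p (t • q) = Real.cosh (t * √(mink q q)) • p +
      (Real.sinh (t * √(mink q q)) / √(mink q q)) • q := by
  have hs : √(mink (t • q) (t • q)) = |t| * √(mink q q) := by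
    rw [mink_smul_left, mink_smul_right, ← mul_assoc, Real.sqrt_mul (mul_self_nonneg t),
      Real.sqrt_mul_self_eq_abs]
  rw [hexp, hs, smul_smul]
  rcases abs_choice t with h | h <;> rw [h]
  · rcases eq_or_ne t 0 with rfl | ht
    · simp
    · congr 2
      field_simp
  · rcases eq_or_ne t 0 with rfl | ht
    · simp
    · rw [neg_mul, Real.cosh_neg, Real.sinh_neg]
      congr 2
      field_simp

theorem hasDerivAt_hexp (p : E4) {q : E4} (hq : q = 0 ∨ 0 < mink q q) :
    HasDerivAt (fun t : ℝ => hexp p (t • q)) q 0 := by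
  simp only [hexp_smul]
  have hl : HasDerivAt (fun t : ℝ => t * √(mink q q)) (√(mink q q)) 0 := by
    simpa using (hasDerivAt_id (0 : ℝ)).mul_const (√(mink q q))
  have := (hl.cosh.smul_const p).add ((hl.sinh.div_const (√(mink q q))).smul_const q)
  refine HasDerivAt.congr_deriv this ?_
  rcases hq with rfl | hq
  · simp [mink]
  · have : √(mink q q) ≠ 0 := (Real.sqrt_pos.2 hq).ne'
    simp [this]

theorem mink_hexp {p q : E4} (hp : mink p p = -1) (hpq : mink p q = 0)
    (hq : q = 0 ∨ 0 < mink q q) (t : ℝ) : mink (hexp p (t • q)) (hexp p (t • q)) = -1 := by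
  rw [hexp_smul]
  simp only [mink_add_left, mink_add_right, mink_smul_left, mink_smul_right, hp, hpq,
    mink_comm q p]
  rcases hq with rfl | hq
  · simp [mink]
  · have h0 : √(mink q q) ≠ 0 := (Real.sqrt_pos.2 hq).ne'
    have h1 : mink q q = √(mink q q) ^ 2 := (Real.sq_sqrt hq.le).symm
    have := Real.cosh_sq (t * √(mink q q))
    rw [h1, Real.sqrt_sq (Real.sqrt_nonneg _)]
    have hs : Real.sinh (t * √(mink q q)) / √(mink q q) *
        (Real.sinh (t * √(mink q q)) / √(mink q q) * √(mink q q) ^ 2) =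
        Real.sinh (t * √(mink q q)) ^ 2 := by field_simp
    linarith

@[simp] theorem hexp_zero (p : E4) : hexp p 0 = p := by simp [hexp, mink]

/-! ### The dihedral angle -/

theorem tangentAngle_comm (x y : E4) : tangentAngle x y = tangentAngle y x := by
  rw [tangentAngle, tangentAngle, mink_comm, mul_comm]

theorem dihedralAngle_comm (a b c d : E4) : dihedralAngle a b c d = dihedralAngle a b d c :=
  tangentAngle_comm _ _

/-- The component of `c` orthogonal to the edge `ab`, in a form that is symmetric in `a`, `b`. -/
theorem orthTo_direction {a b : E4} (ha : mink a a = -1) (hb : mink b b = -1)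
    (hab : mink a b ^ 2 - 1 ≠ 0) (c : E4) :
    orthTo (direction a b) (direction a c) =
      c - ((mink a c + mink a b * mink b c) / (mink a b ^ 2 - 1)) • a
        - ((mink b c + mink a b * mink a c) / (mink a b ^ 2 - 1)) • b := by
  have h1 : mink (direction a b) (direction a b) = mink a b ^ 2 - 1 := by
    simp only [direction, mink_add_left, mink_add_right, mink_smul_left, mink_smul_right,
      mink_comm b a, ha, hb]; ring
  have h2 : mink (direction a b) (direction a c) = mink b c + mink a b * mink a c := by
    simp only [direction, mink_add_left, mink_add_right, mink_smul_left, mink_smul_right,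
      mink_comm b a, ha]; ring
  rw [orthTo, h1, h2]
  have h3 : (mink a c + mink a b * mink b c) / (mink a b ^ 2 - 1) =
      (mink b c + mink a b * mink a c) / (mink a b ^ 2 - 1) * mink a b - mink a c := by
    field_simp; ring
  rw [h3, direction, direction]
  module

theorem dihedralAngle_swap {a b : E4} (ha : mink a a = -1) (hb : mink b b = -1)
    (hab : mink a b ^ 2 - 1 ≠ 0) (c d : E4) :
    dihedralAngle b a c d = dihedralAngle a b c d := by
  have hba : mink b a ^ 2 - 1 ≠ 0 := by rwa [mink_comm]
  have key : ∀ x, orthTo (direction b a) (direction b x) =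
      orthTo (direction a b) (direction a x) := by
    intro x
    rw [orthTo_direction ha hb hab, orthTo_direction hb ha hba, mink_comm b a]
    abel
  rw [dihedralAngle, dihedralAngle, key, key]

/-! ### The total angle around an interior edge -/

theorem angle_eq_arg {z w : ℂ} (h : 0 < (starRingEnd ℂ z * w).im) :
    InnerProductGeometry.angle z w = (w / z).arg ∧ 0 < (w / z).arg ∧ (w / z).arg < Real.pi := by
  have hz : z ≠ 0 := by rintro rfl; simp at h
  have hw : w ≠ 0 := by rintro rfl; simp at h
  have him : 0 < (w / z).im := by
    have : (w / z).im = (starRingEnd ℂ z * w).im / Complex.normSq z := by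
      rw [Complex.div_im, Complex.mul_im, Complex.conj_re, Complex.conj_im]; ring
    rw [this]
    exact div_pos h (Complex.normSq_pos.2 hz)
  have h0 : 0 < (w / z).arg := by
    refine lt_of_le_of_ne (Complex.arg_nonneg_iff.2 him.le) fun h => ?_
    rw [eq_comm, Complex.arg_eq_zero_iff] at h
    exact him.ne' h.2
  refine ⟨?_, h0, ?_⟩
  · rw [InnerProductGeometry.angle_comm, Complex.angle_eq_abs_arg hw hz, abs_of_pos h0]
  · exact Complex.arg_lt_pi_iff.2 (Or.inr him.ne')

/-- Four vectors of the plane, each of which follows the preceding one counterclockwise by an angle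
less than `π`, wind once around the origin: four angles in `(0, π)` whose sum is a multiple of `2π`
add up to `2π`. -/
theorem angle_sum_four {z₁ z₂ z₃ z₄ : ℂ} (h₁₂ : 0 < (starRingEnd ℂ z₁ * z₂).im)
    (h₂₃ : 0 < (starRingEnd ℂ z₂ * z₃).im) (h₃₄ : 0 < (starRingEnd ℂ z₃ * z₄).im)
    (h₄₁ : 0 < (starRingEnd ℂ z₄ * z₁).im) :
    InnerProductGeometry.angle z₁ z₂ + InnerProductGeometry.angle z₂ z₃ +
      InnerProductGeometry.angle z₃ z₄ + InnerProductGeometry.angle z₄ z₁ = 2 * Real.pi := by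
  have n1 : z₁ ≠ 0 := by rintro rfl; simp at h₁₂
  have n2 : z₂ ≠ 0 := by rintro rfl; simp at h₂₃
  have n3 : z₃ ≠ 0 := by rintro rfl; simp at h₃₄
  have n4 : z₄ ≠ 0 := by rintro rfl; simp at h₄₁
  obtain ⟨e1, p1, q1⟩ := angle_eq_arg h₁₂
  obtain ⟨e2, p2, q2⟩ := angle_eq_arg h₂₃
  obtain ⟨e3, p3, q3⟩ := angle_eq_arg h₃₄
  obtain ⟨e4, p4, q4⟩ := angle_eq_arg h₄₁
  rw [e1, e2, e3, e4]
  set S := (z₂ / z₁).arg + (z₃ / z₂).arg + (z₄ / z₃).arg + (z₁ / z₄).arg with hS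
  have hmod : (S : Real.Angle) = ((0 : ℝ) : Real.Angle) := by
    rw [hS]
    simp only [Real.Angle.coe_add, Complex.arg_div_coe_angle, n1, n2, n3, n4, ne_eq,
      not_false_eq_true, Real.Angle.coe_zero]
    abel
  rw [Real.Angle.angle_eq_iff_two_pi_dvd_sub] at hmod
  obtain ⟨k, hk⟩ := hmod
  have hpi := Real.pi_pos
  have hk0 : (0 : ℝ) < k := by
    by_contra hcon
    have : 2 * Real.pi * (k : ℝ) ≤ 0 := mul_nonpos_of_nonneg_of_nonpos (by positivity) (by linarith)
    linarith
  have hk2 : (k : ℝ) < 2 := by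
    by_contra hcon
    have : 2 * Real.pi * 2 ≤ 2 * Real.pi * (k : ℝ) :=
      mul_le_mul_of_nonneg_left (by linarith) (by positivity)
    linarith
  have : k = 1 := by
    have h1 : 0 < k := by exact_mod_cast hk0
    have h2 : k < 2 := by exact_mod_cast hk2
    omega
  rw [this] at hk
  push_cast at hk
  linarith

/-- The point `(1, 0, 0, 0)` of hyperbolic space. -/
def origin : E4 := ![1, 0, 0, 0]

/-- The determinant of the spatial parts of three vectors of Minkowski space. -/
def det3 (x y z : E4) : ℝ :=
  x 1 * (y 2 * z 3 - y 3 * z 2) - x 2 * (y 1 * z 3 - y 3 * z 1) + x 3 * (y 1 * z 2 - y 2 * z 1)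

/-- The scalar product of the cross products `b × x` and `b × y` of the spatial parts. -/
def crossDot (b x y : E4) : ℝ :=
  (b 2 * x 3 - b 3 * x 2) * (b 2 * y 3 - b 3 * y 2) +
  (b 3 * x 1 - b 1 * x 3) * (b 3 * y 1 - b 1 * y 3) +
  (b 1 * x 2 - b 2 * x 1) * (b 1 * y 2 - b 2 * y 1)

/-- Dihedral angles at an edge through the origin are the angles of spherical triangles. -/
theorem dihedralAngle_origin {b : E4} (hb : 0 < b 1 ^ 2 + b 2 ^ 2 + b 3 ^ 2) (c d : E4) :
    dihedralAngle origin b c d =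
      Real.arccos (crossDot b c d / (√(crossDot b c c) * √(crossDot b d d))) := by
  have key : ∀ x y : E4, mink (orthTo (direction origin b) (direction origin x))
      (orthTo (direction origin b) (direction origin y)) =
      crossDot b x y / (b 1 ^ 2 + b 2 ^ 2 + b 3 ^ 2) := by
    intro x y
    have hd : ∀ x : E4, direction origin x = ![0, x 1, x 2, x 3] := by
      intro x; ext i; fin_cases i <;> simp [direction, origin, mink]
    rw [hd, hd, hd]
    simp only [orthTo, mink, Pi.sub_apply, Pi.smul_apply, smul_eq_mul, Matrix.cons_val, crossDot]
    have : -(0 * 0) + b 1 * b 1 + b 2 * b 2 + b 3 * b 3 = b 1 ^ 2 + b 2 ^ 2 + b 3 ^ 2 := by ring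
    rw [this]
    field_simp
    ring
  rw [dihedralAngle, tangentAngle, key, key, key, Real.sqrt_div' _ hb.le, Real.sqrt_div' _ hb.le]
  congr 1
  rw [div_mul_div_comm, Real.mul_self_sqrt hb.le]
  field_simp

theorem crossDot_mul (b e c d : E4) :
    crossDot b e c * crossDot b e d +
      (b 1 ^ 2 + b 2 ^ 2 + b 3 ^ 2) * (det3 b e c * det3 b e d) =
      crossDot b e e * crossDot b c d := by
  simp only [crossDot, det3]; ring

theorem crossDot_mul_det3 (b e c d : E4) :
    crossDot b e c * det3 b e d - crossDot b e d * det3 b e c =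
      crossDot b e e * det3 b c d := by
  simp only [crossDot, det3]; ring

/-- If the spatial parts of `c₁`, `c₂`, `c₃`, `c₄` follow each other counterclockwise around the
axis `b`, then the dihedral angles at `b` add up to `2π`. -/
theorem dihedralAngle_sum_four {b c₁ c₂ c₃ c₄ : E4} (h₁₂ : 0 < det3 b c₁ c₂)
    (h₂₃ : 0 < det3 b c₂ c₃) (h₃₄ : 0 < det3 b c₃ c₄) (h₄₁ : 0 < det3 b c₄ c₁) :
    dihedralAngle origin b c₁ c₂ + dihedralAngle origin b c₂ c₃ +
      dihedralAngle origin b c₃ c₄ + dihedralAngle origin b c₄ c₁ = 2 * Real.pi := by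
  have hb : 0 < b 1 ^ 2 + b 2 ^ 2 + b 3 ^ 2 := by
    by_contra h
    have e1 : b 1 = 0 := pow_eq_zero_iff two_ne_zero |>.1 (by
      nlinarith [sq_nonneg (b 1), sq_nonneg (b 2), sq_nonneg (b 3)])
    have e2 : b 2 = 0 := pow_eq_zero_iff two_ne_zero |>.1 (by
      nlinarith [sq_nonneg (b 1), sq_nonneg (b 2), sq_nonneg (b 3)])
    have e3 : b 3 = 0 := pow_eq_zero_iff two_ne_zero |>.1 (by
      nlinarith [sq_nonneg (b 1), sq_nonneg (b 2), sq_nonneg (b 3)])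
    simp [det3, e1, e2, e3] at h₁₂
  have hg : 0 < crossDot b c₁ c₁ := by
    by_contra h
    set p := b 2 * c₁ 3 - b 3 * c₁ 2 with hp
    set q := b 3 * c₁ 1 - b 1 * c₁ 3 with hq
    set r := b 1 * c₁ 2 - b 2 * c₁ 1 with hr
    have hh : crossDot b c₁ c₁ = p ^ 2 + q ^ 2 + r ^ 2 := by
      simp only [crossDot, hp, hq, hr]; ring
    rw [hh] at h
    have e1 : p = 0 := pow_eq_zero_iff two_ne_zero |>.1 (by
      nlinarith [sq_nonneg p, sq_nonneg q, sq_nonneg r])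
    have e2 : q = 0 := pow_eq_zero_iff two_ne_zero |>.1 (by
      nlinarith [sq_nonneg p, sq_nonneg q, sq_nonneg r])
    have e3 : r = 0 := pow_eq_zero_iff two_ne_zero |>.1 (by
      nlinarith [sq_nonneg p, sq_nonneg q, sq_nonneg r])
    have : det3 b c₁ c₂ = p * c₂ 1 + q * c₂ 2 + r * c₂ 3 := by
      simp only [det3, hp, hq, hr]; ring
    rw [this, e1, e2, e3] at h₁₂
    simp at h₁₂
  set R := b 1 ^ 2 + b 2 ^ 2 + b 3 ^ 2 with hR
  -- a similarity of the plane orthogonal to `b` with `ℂ`, taking `c₁` to the positive real axis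
  let z : E4 → ℂ := fun c => ⟨crossDot b c₁ c, √R * det3 b c₁ c⟩
  have hRR : √R * √R = R := Real.mul_self_sqrt hb.le
  have hin : ∀ c d, inner ℝ (z c) (z d) = crossDot b c₁ c₁ * crossDot b c d := by
    intro c d
    rw [← crossDot_mul b c₁ c d, Complex.inner, Complex.mul_re, Complex.conj_re, Complex.conj_im,
      ← hR, ← hRR]
    simp only [z]; ring
  have him : ∀ c d, 0 < det3 b c d → 0 < (starRingEnd ℂ (z c) * z d).im := by
    intro c d h
    have : (starRingEnd ℂ (z c) * z d).im = √R * (crossDot b c₁ c₁ * det3 b c d) := by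
      rw [← crossDot_mul_det3 b c₁ c d, Complex.mul_im, Complex.conj_re, Complex.conj_im]
      simp only [z]; ring
    rw [this]
    have := Real.sqrt_pos.2 hb
    positivity
  have hang : ∀ c d, dihedralAngle origin b c d = InnerProductGeometry.angle (z c) (z d) := by
    intro c d
    rw [dihedralAngle_origin hb, InnerProductGeometry.angle, hin, norm_eq_sqrt_real_inner,
      norm_eq_sqrt_real_inner, hin, hin, Real.sqrt_mul hg.le, Real.sqrt_mul hg.le]
    congr 1
    have h1 := Real.mul_self_sqrt hg.le
    have : √(crossDot b c₁ c₁) * √(crossDot b c c) * (√(crossDot b c₁ c₁) * √(crossDot b d d)) =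
        crossDot b c₁ c₁ * (√(crossDot b c c) * √(crossDot b d d)) := by
      linear_combination (√(crossDot b c c) * √(crossDot b d d)) * h1
    rw [this, mul_div_mul_left _ _ hg.ne']
  simp only [hang]
  exact angle_sum_four (him _ _ h₁₂) (him _ _ h₂₃) (him _ _ h₃₄) (him _ _ h₄₁)

/-! ### The boundary complex of the four-dimensional cross-polytope -/

/-- The vertices `± eᵢ` of the four-dimensional cross-polytope: `(i, true)` stands for `eᵢ` and
`(i, false)` for `-eᵢ`. -/
abbrev Vert : Type := Fin 4 × Bool

/-- The facets of the four-dimensional cross-polytope: the sets that contain one vertex from each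
antipodal pair. -/
def crossTets : Finset (Finset Vert) :=
  Finset.univ.filter fun s => s.card = 4 ∧ s.image Prod.fst = Finset.univ

theorem mem_crossTets {s : Finset Vert} :
    s ∈ crossTets ↔ s.card = 4 ∧ s.image Prod.fst = Finset.univ := by
  simp [crossTets]

theorem eq_of_fst_eq {s : Finset Vert} (hs : s ∈ crossTets) {a b : Vert} (ha : a ∈ s) (hb : b ∈ s)
    (h : a.1 = b.1) : a = b := by
  rw [mem_crossTets] at hs
  have : (s.image Prod.fst).card = s.card := by rw [hs.1, hs.2]; simp
  exact Finset.card_image_iff.1 this ha hb h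

theorem exists_mem_of_mem_crossTets {s : Finset Vert} (hs : s ∈ crossTets) (i : Fin 4) :
    ∃ σ, (i, σ) ∈ s := by
  have : i ∈ s.image Prod.fst := by rw [(mem_crossTets.1 hs).2]; simp
  obtain ⟨⟨j, σ⟩, h, rfl⟩ := Finset.mem_image.1 this
  exact ⟨σ, h⟩

theorem quad_mem_crossTets {a b c d : Vert} :
    ({a, b, c, d} : Finset Vert) ∈ crossTets ↔
      ({a.1, b.1, c.1, d.1} : Finset (Fin 4)) = Finset.univ := by
  have him : ({a, b, c, d} : Finset Vert).image Prod.fst = {a.1, b.1, c.1, d.1} := by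
    simp [Finset.image_insert]
  rw [mem_crossTets, him]
  refine ⟨fun h => h.2, fun h => ⟨le_antisymm Finset.card_le_four ?_, h⟩⟩
  have h4 : (({a, b, c, d} : Finset Vert).image Prod.fst).card = 4 := by rw [him, h]; simp
  exact h4.symm.le.trans Finset.card_image_le

theorem quad_eq_univ {i j k l : Fin 4} : ({i, j, k, l} : Finset (Fin 4)) = Finset.univ ↔
    i ≠ j ∧ i ≠ k ∧ i ≠ l ∧ j ≠ k ∧ j ≠ l ∧ k ≠ l := by
  revert i j k l; decide

theorem sum_complementary {i j k l : Fin 4} (h : ({i, j, k, l} : Finset (Fin 4)) = Finset.univ)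
    (F : Fin 4 → Fin 4 → ℝ) :
    (∑ k', ∑ l', if ({i, j, k', l'} : Finset (Fin 4)) = Finset.univ then F k' l' else 0) =
      F k l + F l k := by
  have hne := quad_eq_univ.1 h
  have hiff : ∀ p : Fin 4 × Fin 4, ({i, j, p.1, p.2} : Finset (Fin 4)) = Finset.univ ↔
      p ∈ ({(k, l), (l, k)} : Finset (Fin 4 × Fin 4)) := by
    rintro ⟨k', l'⟩
    rw [quad_eq_univ, Finset.mem_insert, Finset.mem_singleton, Prod.mk.injEq, Prod.mk.injEq]
    dsimp only
    omega
  have h2 : ((k, l) : Fin 4 × Fin 4) ≠ (l, k) := fun he => hne.2.2.2.2.2 (Prod.mk.inj he).1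
  rw [← Fintype.sum_prod_type'
    (f := fun k' l' => if ({i, j, k', l'} : Finset (Fin 4)) = Finset.univ then F k' l' else 0)]
  simp only [hiff]
  rw [← Finset.sum_filter, Finset.filter_mem_eq_inter, Finset.univ_inter, Finset.sum_pair h2]

/-- The cone angle at an edge of the cross-polytope is the sum of the dihedral angles of the four
facets around it. -/
theorem coneAngle_crossTets (pos : Finset Vert → Vert → E4) {i j k l : Fin 4}
    (h : ({i, j, k, l} : Finset (Fin 4)) = Finset.univ) (σ τ : Bool) :
    coneAngle crossTets pos (i, σ) (j, τ) = ∑ ρ : Bool, ∑ υ : Bool,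
      dihedralAngle (pos {(i, σ), (j, τ), (k, ρ), (l, υ)} (i, σ))
        (pos {(i, σ), (j, τ), (k, ρ), (l, υ)} (j, τ))
        (pos {(i, σ), (j, τ), (k, ρ), (l, υ)} (k, ρ))
        (pos {(i, σ), (j, τ), (k, ρ), (l, υ)} (l, υ)) := by
  let D : Vert → Vert → ℝ := fun c d =>
    dihedralAngle (pos {(i, σ), (j, τ), c, d} (i, σ)) (pos {(i, σ), (j, τ), c, d} (j, τ))
      (pos {(i, σ), (j, τ), c, d} c) (pos {(i, σ), (j, τ), c, d} d)
  have hD : ∀ c d, D c d = D d c := by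
    intro c d
    simp only [D]
    rw [dihedralAngle_comm, Finset.pair_comm c d]
  let F : Fin 4 → Fin 4 → ℝ := fun k' l' => ∑ ρ : Bool, ∑ υ : Bool, 1 / 2 * D (k', ρ) (l', υ)
  have h1 : coneAngle crossTets pos (i, σ) (j, τ) =
      ∑ k', ∑ l', if ({i, j, k', l'} : Finset (Fin 4)) = Finset.univ then F k' l' else 0 := by
    simp only [coneAngle, quad_mem_crossTets, Fintype.sum_prod_type]
    refine Finset.sum_congr rfl fun k' _ => ?_
    rw [Finset.sum_comm]
    refine Finset.sum_congr rfl fun l' _ => ?_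
    split_ifs with hc
    · simp only [F, D]
    · simp
  have h2 : F l k = F k l := by
    simp only [F]
    rw [Finset.sum_comm]
    refine Finset.sum_congr rfl fun ρ _ => Finset.sum_congr rfl fun υ _ => ?_
    rw [hD]
  rw [h1, sum_complementary h, h2]
  simp only [F, ← Finset.mul_sum]
  simp only [D]
  ring

/-- There are no facets around a pair of equal or antipodal vertices. -/
theorem coneAngle_of_fst_eq (pos : Finset Vert → Vert → E4) {a b : Vert} (h : a.1 = b.1) :
    coneAngle crossTets pos a b = 0 := by
  simp only [coneAngle, quad_mem_crossTets, quad_eq_univ]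
  exact Finset.sum_eq_zero fun c _ => Finset.sum_eq_zero fun d _ => if_neg fun hc => hc.1 h

/-- The geometric realization of the boundary complex of the cross-polytope. -/
abbrev CrossSpace : Type :=
  {x : Vert → ℝ // (∀ v, 0 ≤ x v) ∧ ∑ v, x v = 1 ∧ ∃ s ∈ crossTets, ∀ v, v ∉ s → x v = 0}

/-- The sign `± 1` encoded by a Boolean. -/
def sg (b : Bool) : ℝ := if b then 1 else -1

@[simp] theorem sg_true : sg true = 1 := rfl
@[simp] theorem sg_false : sg false = -1 := rfl

namespace CrossSpace

theorem apply_true_or_false (x : CrossSpace) (i : Fin 4) :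
    x.1 (i, true) = 0 ∨ x.1 (i, false) = 0 := by
  obtain ⟨s, hs, h⟩ := x.2.2.2
  by_contra hcon
  rw [not_or] at hcon
  have h1 : (i, true) ∈ s := by by_contra hc; exact hcon.1 (h _ hc)
  have h2 : (i, false) ∈ s := by by_contra hc; exact hcon.2 (h _ hc)
  simpa using eq_of_fst_eq hs h1 h2 rfl

/-- The point `∑ x(± eᵢ) (± eᵢ)` on the boundary of the cross-polytope in `ℝ⁴`. -/
noncomputable def toVec (x : CrossSpace) : EuclideanSpace ℝ (Fin 4) :=
  WithLp.toLp 2 fun i => x.1 (i, true) - x.1 (i, false)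

theorem toVec_apply (x : CrossSpace) (i : Fin 4) :
    x.toVec i = x.1 (i, true) - x.1 (i, false) := rfl

theorem max_toVec (x : CrossSpace) (v : Vert) : max (sg v.2 * x.toVec v.1) 0 = x.1 v := by
  obtain ⟨i, σ⟩ := v
  rw [toVec_apply]
  have h1 := x.2.1 (i, true)
  have h2 := x.2.1 (i, false)
  rcases x.apply_true_or_false i with h | h <;> cases σ <;> simp only [sg_true, sg_false, h]
  · rw [max_eq_left] <;> linarith
  · rw [max_eq_right]; linarith
  · rw [max_eq_right]; linarith
  · rw [max_eq_left] <;> linarith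

theorem sum_abs_toVec (x : CrossSpace) : ∑ i, |x.toVec i| = 1 := by
  rw [← x.2.2.1, Fintype.sum_prod_type]
  refine Finset.sum_congr rfl fun i _ => ?_
  rw [Fintype.sum_bool, toVec_apply]
  have h1 := x.2.1 (i, true)
  have h2 := x.2.1 (i, false)
  rcases x.apply_true_or_false i with h | h <;> rw [h]
  · rw [zero_sub, abs_neg, abs_of_nonneg h2, zero_add]
  · rw [sub_zero, abs_of_nonneg h1, add_zero]

theorem toVec_ne_zero (x : CrossSpace) : x.toVec ≠ 0 := by
  intro h
  have := x.sum_abs_toVec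
  simp [h] at this

theorem continuous_toVec : Continuous toVec := by
  refine (PiLp.continuous_toLp 2 _).comp (continuous_pi fun i => ?_)
  exact ((continuous_apply (i, true)).comp continuous_subtype_val).sub
    ((continuous_apply (i, false)).comp continuous_subtype_val)

theorem sum_max (z : Fin 4 → ℝ) : ∑ v : Vert, max (sg v.2 * z v.1) 0 = ∑ i, |z i| := by
  rw [Fintype.sum_prod_type]
  refine Finset.sum_congr rfl fun i _ => ?_
  rw [Fintype.sum_bool]
  rcases le_total 0 (z i) with h | h
  · rw [abs_of_nonneg h, max_eq_left, max_eq_right] <;> simp [h]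
  · rw [abs_of_nonpos h, max_eq_right, max_eq_left] <;> simp [h]

theorem sum_abs_pos {y : EuclideanSpace ℝ (Fin 4)} (hy : y ∈ Metric.sphere 0 1) :
    0 < ∑ i, |y i| := by
  refine lt_of_le_of_ne (Finset.sum_nonneg fun i _ => abs_nonneg _) fun h => ?_
  have h0 : y = 0 := by
    ext i
    have := (Finset.sum_eq_zero_iff_of_nonneg fun i _ => abs_nonneg (y i)).1 h.symm i
      (Finset.mem_univ i)
    simpa using this
  simp [h0] at hy

/-- The point of the boundary complex on the ray through `y`. -/
noncomputable def ofSphere (y : Metric.sphere (0 : EuclideanSpace ℝ (Fin 4)) 1) : CrossSpace :=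
  ⟨fun v => max (sg v.2 * y.1 v.1) 0 / ∑ i, |y.1 i|, fun v =>
    div_nonneg (le_max_right _ _) (sum_abs_pos y.2).le, by
      rw [← Finset.sum_div, sum_max, div_self (sum_abs_pos y.2).ne'],
    Finset.univ.image fun i => (i, decide (0 ≤ y.1 i)), by
      rw [mem_crossTets, Finset.card_image_of_injective _ fun i j h => (Prod.mk.inj h).1,
        Finset.image_image]
      exact ⟨by simp, Finset.image_id⟩, by
      rintro ⟨i, σ⟩ h
      have hs : σ ≠ decide (0 ≤ y.1 i) := by
        rintro rfl
        exact h (Finset.mem_image_of_mem _ (Finset.mem_univ i))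
      change max (sg σ * y.1 i) 0 / _ = 0
      rw [max_eq_right, zero_div]
      cases σ
      · have : 0 ≤ y.1 i := by simpa using hs
        simpa using this
      · have : y.1 i < 0 := by simpa using hs
        simpa using this.le⟩

/-- The boundary of the cross-polytope is homeomorphic to the sphere, by radial projection. -/
noncomputable def homeoSphere : CrossSpace ≃ₜ Metric.sphere (0 : EuclideanSpace ℝ (Fin 4)) 1 where
  toFun x := ⟨‖x.toVec‖⁻¹ • x.toVec, by
    rw [mem_sphere_zero_iff_norm, norm_smul, norm_inv, norm_norm,
      inv_mul_cancel₀ (norm_ne_zero_iff.2 x.toVec_ne_zero)]⟩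
  invFun := ofSphere
  left_inv x := by
    have hpos : 0 < ‖x.toVec‖⁻¹ := inv_pos.2 (norm_pos_iff.2 x.toVec_ne_zero)
    ext v
    have h1 : ∀ i, (‖x.toVec‖⁻¹ • x.toVec) i = ‖x.toVec‖⁻¹ * x.toVec i := fun i => rfl
    simp only [ofSphere, h1, abs_mul, abs_of_pos hpos, ← Finset.mul_sum, sum_abs_toVec, mul_one]
    have h2 : max (sg v.2 * (‖x.toVec‖⁻¹ * x.toVec v.1)) 0 =
        ‖x.toVec‖⁻¹ * max (sg v.2 * x.toVec v.1) 0 := by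
      rw [mul_max_of_nonneg _ _ hpos.le]
      congr 1 <;> ring
    rw [h2, max_toVec, mul_div_cancel_left₀ _ hpos.ne']
  right_inv y := by
    have hS := sum_abs_pos y.2
    have hv : (ofSphere y).toVec = (∑ i, |y.1 i|)⁻¹ • y.1 := by
      ext i
      have : ((∑ i, |y.1 i|)⁻¹ • y.1) i = (∑ i, |y.1 i|)⁻¹ * y.1 i := rfl
      rw [toVec_apply, this]
      simp only [ofSphere, sg_true, sg_false, ← sub_div, one_mul, neg_one_mul]
      have : max (y.1 i) 0 - max (-y.1 i) 0 = y.1 i := by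
        rcases le_total 0 (y.1 i) with h | h
        · rw [max_eq_left h, max_eq_right (by linarith), sub_zero]
        · rw [max_eq_right h, max_eq_left (by linarith), zero_sub, neg_neg]
      rw [this, div_eq_inv_mul]
    have hn : ‖y.1‖ = 1 := mem_sphere_zero_iff_norm.1 y.2
    ext1
    simp only [hv]
    rw [norm_smul, hn, mul_one, norm_inv, Real.norm_of_nonneg hS.le, inv_inv, smul_smul,
      mul_inv_cancel₀ hS.ne', one_smul]
  continuous_toFun := by
    refine Continuous.subtype_mk ?_ _
    exact (continuous_toVec.norm.inv₀ fun x => norm_ne_zero_iff.2 x.toVec_ne_zero).smul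
      continuous_toVec
  continuous_invFun := by
    refine Continuous.subtype_mk (continuous_pi fun v => ?_) _
    refine Continuous.div ?_ ?_ fun y => (sum_abs_pos y.2).ne'
    · fun_prop
    · fun_prop

theorem smul_homeoSphere (x : CrossSpace) (r : ℝ) :
    ∃ c : ℝ, 0 < c ∧ r • (homeoSphere x : EuclideanSpace ℝ (Fin 4)) = (r * c) • x.toVec :=
  ⟨‖x.toVec‖⁻¹, inv_pos.2 (norm_pos_iff.2 x.toVec_ne_zero), by rw [mul_smul]; rfl⟩

/-- The full subcomplex on the vertices `± e₀, ± e₁, ± e₂` has the 1-skeleton of the octahedron as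
its 1-skeleton. -/
theorem mem_skeleton_iff (x : CrossSpace) :
    (∃ r : ℝ, 0 < r ∧ r • (homeoSphere x : EuclideanSpace ℝ (Fin 4)) ∈ octahedronSkeleton) ↔
      ∃ a b : Vert, (a.1 ≠ b.1 ∧ a.1 ≠ 3 ∧ b.1 ≠ 3) ∧ ∀ v, v ≠ a → v ≠ b → x.1 v = 0 := by
  constructor
  · rintro ⟨r, hr, i, j, hij, σ, τ, hσ, hτ, α, β, hα, hβ, -, heq⟩
    obtain ⟨c, hc, hrc⟩ := x.smul_homeoSphere r
    rw [hrc] at heq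
    have hrc0 : 0 < r * c := mul_pos hr hc
    have hij' : i.castSucc ≠ j.castSucc := fun h => hij (Fin.castSucc_injective _ h)
    have hcoord : ∀ k, r * c * x.toVec k =
        α * (if k = i.castSucc then σ else 0) + β * (if k = j.castSucc then τ else 0) := by
      intro k
      have := congrArg (fun z : EuclideanSpace ℝ (Fin 4) => z k) heq
      simpa [eq_comm] using this.symm
    -- the barycentric coordinates at the ends of an axis are determined by the sign of `toVec`
    have hzero : ∀ v : Vert, sg v.2 * x.toVec v.1 ≤ 0 → x.1 v = 0 := by
      intro v hv
      rw [← x.max_toVec v, max_eq_right hv]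
    have hsgn : ∀ (k : Fin 4) (s γ : ℝ), (s = 1 ∨ s = -1) → 0 ≤ γ → r * c * x.toVec k = γ * s →
        ∀ ρ, ρ ≠ decide (s = 1) → x.1 (k, ρ) = 0 := by
      intro k s γ hs hγ hk ρ hρ
      apply hzero
      rcases hs with rfl | rfl
      · have : ρ = false := by simpa using hρ
        subst this
        have : 0 ≤ x.toVec k := by
          by_contra hcon
          nlinarith
        simpa using this
      · have : ρ = true := by
          have h1 : ¬ ((-1 : ℝ) = 1) := by norm_num
          simpa [h1] using hρ
        subst this
        have : x.toVec k ≤ 0 := by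
          by_contra hcon
          nlinarith
        simpa using this
    refine ⟨(i.castSucc, decide (σ = 1)), (j.castSucc, decide (τ = 1)),
      ⟨hij', (Fin.castSucc_lt_last i).ne, (Fin.castSucc_lt_last j).ne⟩, ?_⟩
    rintro ⟨k, ρ⟩ h1 h2
    have hk := hcoord k
    by_cases hki : k = i.castSucc
    · subst hki
      refine hsgn _ σ α hσ hα (by simpa [hij'] using hk) ρ fun h => h1 (by rw [h])
    · by_cases hkj : k = j.castSucc
      · subst hkj
        refine hsgn _ τ β hτ hβ (by simpa [hij'.symm] using hk) ρ fun h => h2 (by rw [h])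
      · have : x.toVec k = 0 := by
          rw [if_neg hki, if_neg hkj, mul_zero, mul_zero, add_zero] at hk
          exact (mul_eq_zero.1 hk).resolve_left hrc0.ne'
        exact hzero _ (by simp [this])
  · rintro ⟨⟨i, σ⟩, ⟨j, τ⟩, ⟨hij, hi, hj⟩, h⟩
    simp only at hij hi hj
    obtain ⟨i, rfl⟩ := Fin.exists_castSucc_eq.2 (show i ≠ Fin.last 3 from hi)
    obtain ⟨j, rfl⟩ := Fin.exists_castSucc_eq.2 (show j ≠ Fin.last 3 from hj)
    have hij' : i ≠ j := fun h => hij (by rw [h])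
    refine ⟨‖x.toVec‖, norm_pos_iff.2 x.toVec_ne_zero, i, j, hij', sg σ, sg τ,
      by cases σ <;> simp, by cases τ <;> simp, x.1 (i.castSucc, σ), x.1 (j.castSucc, τ),
      x.2.1 _, x.2.1 _, ?_, ?_⟩
    · refine Eq.trans ?_ x.2.2.1
      refine (Finset.sum_eq_add_of_mem _ _ (Finset.mem_univ _) (Finset.mem_univ _) ?_ ?_).symm
      · exact fun h => hij (Prod.mk.inj h).1
      · exact fun v _ hv => h v hv.1 hv.2
    · have h1 : ‖x.toVec‖ • (homeoSphere x : EuclideanSpace ℝ (Fin 4)) = x.toVec := by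
        change ‖x.toVec‖ • (‖x.toVec‖⁻¹ • x.toVec) = x.toVec
        rw [smul_smul, mul_inv_cancel₀ (norm_ne_zero_iff.2 x.toVec_ne_zero), one_smul]
      rw [h1]
      have hother : ∀ (k : Fin 4) (ρ : Bool), (k, ρ) ≠ (i.castSucc, σ) →
          (k, ρ) ≠ (j.castSucc, τ) → x.1 (k, ρ) = 0 := fun k ρ => h (k, ρ)
      ext k
      rw [toVec_apply]
      by_cases hki : k = i.castSucc
      · subst hki
        cases σ
        · simp [hij, hother i.castSucc true (by simp) (by simp [hij])]
        · simp [hij, hother i.castSucc false (by simp) (by simp [hij])]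
      · by_cases hkj : k = j.castSucc
        · subst hkj
          cases τ
          · simp [hki, hother j.castSucc true (by simp [hki]) (by simp)]
          · simp [hki, hother j.castSucc false (by simp [hki]) (by simp)]
        · simp [hki, hkj, hother k true (by simp [hki]) (by simp [hkj]),
            hother k false (by simp [hki]) (by simp [hkj])]

end CrossSpace

/-! ### The octahedron and its infinitesimal flex -/

theorem mink_zero_right (x : E4) : mink x 0 = 0 := by simp [mink]

theorem mink_vec (a b c d a' b' c' d' : ℝ) :
    mink ![a, b, c, d] ![a', b', c', d'] = -(a * a') + b * b' + c * c' + d * d' := rfl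

theorem det3_vec (a b c d a' b' c' d' a'' b'' c'' d'' : ℝ) :
    det3 ![a, b, c, d] ![a', b', c', d'] ![a'', b'', c'', d''] =
      b * (c' * d'' - d' * c'') - c * (b' * d'' - d' * b'') + d * (b' * c'' - c' * b'') := rfl

/-- The vertices of the octahedron, followed by the cone point at the origin. The axes are
`0 ↦ A`, `1 ↦ B`, `2 ↦ C`: the quadrilateral `B₊C₊B₋C₋` is a planar dart symmetric with respect to
the reflection that exchanges `B₊` and `B₋`, and `A₊`, `A₋` lie on a line through the origin
perpendicular to the plane of the dart. In the Klein model the dart has the vertices `(0, 7/25)`,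
`(0, -4/5)` and `(±99/325, 56/65)`, so that its opposite sides meet on the line `y = 0` through the
origin; this is the condition for infinitesimal flexibility. -/
noncomputable def octa (v : Vert) : E4 :=
  match v.1 with
  | 0 => ![5 / 4, 0, 0, sg v.2 * (3 / 4)]
  | 1 => ![325 / 132, sg v.2 * (3 / 4), 70 / 33, 0]
  | 2 => if v.2 then ![25 / 24, 0, 7 / 24, 0] else ![5 / 3, 0, -4 / 3, 0]
  | 3 => origin

/-- The velocities of the vertices of the octahedron in its infinitesimal flex. -/
noncomputable def flex (v : Vert) : E4 :=
  match v.1 with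
  | 0 => ![3, 0, 0, sg v.2 * 5]
  | 1 => ![-65 / 11, -(sg v.2 * (10125 / 121)), 250 / 11, 0]
  | 2 => if v.2 then ![-5 / 2, 0, -125 / 14, 0] else ![-4, 0, 5, 0]
  | 3 => 0

theorem octa_zero (σ : Bool) : octa (0, σ) = ![5 / 4, 0, 0, sg σ * (3 / 4)] := rfl
theorem octa_one (σ : Bool) : octa (1, σ) = ![325 / 132, sg σ * (3 / 4), 70 / 33, 0] := rfl
theorem octa_two_true : octa (2, true) = ![25 / 24, 0, 7 / 24, 0] := rfl
theorem octa_two_false : octa (2, false) = ![5 / 3, 0, -4 / 3, 0] := rfl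
theorem octa_three (σ : Bool) : octa (3, σ) = origin := rfl

theorem flex_zero (σ : Bool) : flex (0, σ) = ![3, 0, 0, sg σ * 5] := rfl
theorem flex_three (σ : Bool) : flex (3, σ) = 0 := rfl

theorem octa_mem (v : Vert) : octa v ∈ hyp3 := by
  obtain ⟨i, σ⟩ := v
  fin_cases i <;> cases σ <;>
    norm_num [hyp3, mink_vec, octa, origin]

theorem mink_octa (v : Vert) : mink (octa v) (octa v) = -1 := (octa_mem v).1

theorem mink_octa_flex (v : Vert) : mink (octa v) (flex v) = 0 := by
  obtain ⟨i, σ⟩ := v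
  fin_cases i <;> cases σ <;>
    norm_num [mink_vec, mink_zero_right, octa, flex]

theorem flex_eq_zero_or_pos (v : Vert) : flex v = 0 ∨ 0 < mink (flex v) (flex v) := by
  by_cases h : flex v = 0
  · exact Or.inl h
  · exact Or.inr (mink_self_pos (mink_octa v) (mink_octa_flex v) h)

/-- The flex preserves the lengths of the edges of the octahedron to the first order. -/
theorem mink_flex_edge {v w : Vert} (hvw : v.1 ≠ w.1) (hv : v.1 ≠ 3) (hw : w.1 ≠ 3) :
    mink (flex v) (octa w) + mink (octa v) (flex w) = 0 := by
  obtain ⟨i, σ⟩ := v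
  obtain ⟨j, τ⟩ := w
  fin_cases i <;> fin_cases j <;> first
    | exact absurd rfl hvw
    | exact absurd rfl hv
    | exact absurd rfl hw
    | cases σ <;> cases τ <;> norm_num [mink_vec, octa, flex]

theorem one_lt_mink_edge {v w : Vert} (hvw : v.1 ≠ w.1) (hv : v.1 ≠ 3) (hw : w.1 ≠ 3) :
    1 < -mink (octa v) (octa w) := by
  obtain ⟨i, σ⟩ := v
  obtain ⟨j, τ⟩ := w
  fin_cases i <;> fin_cases j <;> first
    | exact absurd rfl hvw
    | exact absurd rfl hv
    | exact absurd rfl hw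
    | cases σ <;> cases τ <;> norm_num [mink_vec, octa]

theorem linearIndependent_octa_transversal (f : Fin 4 → Bool) :
    LinearIndependent ℝ fun i => octa (i, f i) := by
  rw [Fintype.linearIndependent_iff]
  intro g hg
  rw [Fin.sum_univ_four] at hg
  have hsg : ∀ b, sg b ≠ 0 := by intro b; cases b <;> simp
  have h0 := congrFun hg 0
  have h1 := congrFun hg 1
  have h2 := congrFun hg 2
  have h3 := congrFun hg 3
  rw [octa_zero, octa_one, octa_three] at h0 h1 h2 h3
  generalize f 2 = τ at *
  have e1 : g 1 = 0 := by
    cases τ <;> simpa [octa_two_true, octa_two_false, origin, hsg] using h1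
  have e0 : g 0 = 0 := by
    cases τ <;> simpa [octa_two_true, octa_two_false, origin, hsg] using h3
  have e2 : g 2 = 0 := by
    cases τ <;> simpa [octa_two_true, octa_two_false, origin, e1] using h2
  have e3 : g 3 = 0 := by
    simpa [origin, e0, e1, e2] using h0
  intro i
  fin_cases i <;> assumption

theorem linearIndependent_octa {s : Finset Vert} (hs : s ∈ crossTets) :
    LinearIndependent ℝ fun v : s => octa v := by
  choose f hf using exists_mem_of_mem_crossTets hs
  have heq : ∀ v : s, ((v.1.1, f v.1.1) : Vert) = v.1 := fun v =>
    eq_of_fst_eq hs (hf _) v.2 rfl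
  have hinj : Function.Injective fun v : s => v.1.1 := fun v w h =>
    Subtype.ext (eq_of_fst_eq hs v.2 w.2 h)
  have := (linearIndependent_octa_transversal f).comp _ hinj
  convert this using 1
  exact funext fun v => congrArg octa (heq v).symm

theorem linearIndependent_octa_quad {a b c d : Vert}
    (h : ({a.1, b.1, c.1, d.1} : Finset (Fin 4)) = Finset.univ) :
    LinearIndependent ℝ ![octa a, octa b, octa c, octa d] := by
  have hs := quad_mem_crossTets.2 h
  have hne := quad_eq_univ.1 h
  let e : Fin 4 → ({a, b, c, d} : Finset Vert) :=
    ![⟨a, by simp⟩, ⟨b, by simp⟩, ⟨c, by simp⟩, ⟨d, by simp⟩]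
  have he : Function.Injective fun i => (e i).1.1 := by
    have : (fun i => (e i).1.1) = ![a.1, b.1, c.1, d.1] := by
      ext i; fin_cases i <;> rfl
    rw [this]
    intro i j hij
    fin_cases i <;> fin_cases j <;> simp_all
  have := (linearIndependent_octa hs).comp e fun i j hij => he (by simp only [hij])
  convert this using 1
  ext1 i
  fin_cases i <;> rfl

/-! ### The cone point sees the whole octahedron -/

/-- The total angle at `b` if the neighbours `c true`, `d true`, `c false`, `d false` follow each
other counterclockwise around it. -/
theorem dihedralAngle_sum_bool {b : E4} {c d : Bool → E4}
    (h : ∀ ρ υ, 0 < sg ρ * sg υ * det3 b (c ρ) (d υ)) :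
    ∑ ρ, ∑ υ, dihedralAngle origin b (c ρ) (d υ) = 2 * Real.pi := by
  have hs : ∀ x y, det3 b x y = -det3 b y x := by intro x y; simp only [det3]; ring
  have h1 := h true true
  have h2 := h true false
  have h3 := h false true
  have h4 := h false false
  simp only [sg_true, sg_false] at h1 h2 h3 h4
  have := dihedralAngle_sum_four (b := b) (c₁ := c true) (c₂ := d true) (c₃ := c false)
    (c₄ := d false) (by linarith) (by rw [hs]; linarith) (by linarith) (by rw [hs]; linarith)
  simp only [Fintype.sum_bool]
  rw [dihedralAngle_comm _ _ (d true), dihedralAngle_comm _ _ (d false)] at this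
  linarith

/-- An octahedron, with vertices in hyperbolic space, that is star-shaped with respect to the
origin: the eight tetrahedra spanned by the faces and the origin are oriented like those of the
regular octahedron. -/
structure IsStar (X : Vert → E4) : Prop where
  center : ∀ σ, X (3, σ) = origin
  unit : ∀ v, mink (X v) (X v) = -1
  oriented : ∀ ρ σ τ, 0 < sg ρ * sg σ * sg τ * det3 (X (0, ρ)) (X (1, σ)) (X (2, τ))

theorem IsStar.sum_dihedralAngle {X : Vert → E4} (hX : IsStar X) {i k l : Fin 4}
    (h : ({3, i, k, l} : Finset (Fin 4)) = Finset.univ) (τ : Bool) :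
    ∑ ρ, ∑ υ, dihedralAngle origin (X (i, τ)) (X (k, ρ)) (X (l, υ)) = 2 * Real.pi := by
  -- according to the sign, the four neighbours are traversed in one or the other direction
  have key : ∀ ε : Bool,
      (∀ ρ υ, 0 < sg ε * sg ρ * sg υ * det3 (X (i, τ)) (X (k, ρ)) (X (l, υ))) →
      ∑ ρ, ∑ υ, dihedralAngle origin (X (i, τ)) (X (k, ρ)) (X (l, υ)) = 2 * Real.pi := by
    intro ε hε
    cases ε
    · rw [Finset.sum_comm]
      simp only [fun ρ υ => dihedralAngle_comm origin (X (i, τ)) (X (k, ρ)) (X (l, υ))]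
      refine dihedralAngle_sum_bool (c := fun υ => X (l, υ)) (d := fun ρ => X (k, ρ))
        fun υ ρ => ?_
      have := hε ρ υ
      simp only [sg_false, det3] at this ⊢
      linarith
    · refine dihedralAngle_sum_bool (c := fun ρ => X (k, ρ)) (d := fun υ => X (l, υ))
        fun ρ υ => ?_
      simpa using hε ρ υ
  have hne := quad_eq_univ.1 h
  have hpos : (∀ ρ υ, 0 < sg τ * sg ρ * sg υ * det3 (X (i, τ)) (X (k, ρ)) (X (l, υ))) ∨
      (∀ ρ υ, 0 < -(sg τ * sg ρ * sg υ * det3 (X (i, τ)) (X (k, ρ)) (X (l, υ)))) := by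
    clear key
    fin_cases i <;> fin_cases k <;> fin_cases l <;> first
      | (exfalso; revert hne; decide)
      | (left; intro ρ υ
         first
          | (have := hX.oriented τ ρ υ; simp only [det3] at this ⊢; simp at this ⊢; linarith)
          | (have := hX.oriented ρ υ τ; simp only [det3] at this ⊢; simp at this ⊢; linarith)
          | (have := hX.oriented υ τ ρ; simp only [det3] at this ⊢; simp at this ⊢; linarith))
      | (right; intro ρ υ
         first
          | (have := hX.oriented τ υ ρ; simp only [det3] at this ⊢; simp at this ⊢; linarith)
          | (have := hX.oriented ρ τ υ; simp only [det3] at this ⊢; simp at this ⊢; linarith)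
          | (have := hX.oriented υ ρ τ; simp only [det3] at this ⊢; simp at this ⊢; linarith))
  have hn : sg (!τ) = -sg τ := by cases τ <;> simp
  rcases hpos with hp | hp
  · exact key τ hp
  · refine key (!τ) fun ρ υ => ?_
    have := hp ρ υ
    rw [hn]
    linarith

theorem IsStar.mink_origin_ne {X : Vert → E4} (hX : IsStar X) {v : Vert} (hv : v.1 ≠ 3) :
    mink origin (X v) ^ 2 - 1 ≠ 0 := by
  obtain ⟨i, σ⟩ := v
  have hu := hX.unit (i, σ)
  have h0 : mink origin (X (i, σ)) = -X (i, σ) 0 := by simp [mink, origin]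
  simp only [mink] at hu
  rw [h0]
  intro h
  have hsq : X (i, σ) 1 ^ 2 + X (i, σ) 2 ^ 2 + X (i, σ) 3 ^ 2 = 0 := by linarith
  have e1 : X (i, σ) 1 = 0 := pow_eq_zero_iff two_ne_zero |>.1 (by
    linarith [sq_nonneg (X (i, σ) 1), sq_nonneg (X (i, σ) 2), sq_nonneg (X (i, σ) 3)])
  have e2 : X (i, σ) 2 = 0 := pow_eq_zero_iff two_ne_zero |>.1 (by
    linarith [sq_nonneg (X (i, σ) 1), sq_nonneg (X (i, σ) 2), sq_nonneg (X (i, σ) 3)])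
  have e3 : X (i, σ) 3 = 0 := pow_eq_zero_iff two_ne_zero |>.1 (by
    linarith [sq_nonneg (X (i, σ) 1), sq_nonneg (X (i, σ) 2), sq_nonneg (X (i, σ) 3)])
  fin_cases i
  · have := hX.oriented σ true true
    simp only [det3] at this
    simp_all
  · have := hX.oriented true σ true
    simp only [det3] at this
    simp_all
  · have := hX.oriented true true σ
    simp only [det3] at this
    simp_all
  · exact hv rfl

/-- The position at time `t` of the vertices of the flexing octahedron. -/
noncomputable def flexMove (t : ℝ) (v : Vert) : E4 := hexp (octa v) (t • flex v)

@[simp] theorem flexMove_zero (v : Vert) : flexMove 0 v = octa v := by simp [flexMove]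

theorem mink_flexMove (t : ℝ) (v : Vert) : mink (flexMove t v) (flexMove t v) = -1 :=
  mink_hexp (mink_octa v) (mink_octa_flex v) (flex_eq_zero_or_pos v) t

theorem hasDerivAt_flexMove (v : Vert) : HasDerivAt (fun t => flexMove t v) (flex v) 0 :=
  hasDerivAt_hexp _ (flex_eq_zero_or_pos v)

theorem eventually_isStar_flexMove : ∀ᶠ t in 𝓝 (0 : ℝ), IsStar (flexMove t) := by
  have hc : ∀ v (i : Fin 4), ContinuousAt (fun t => flexMove t v i) 0 := fun v i =>
    (continuous_apply i).continuousAt.comp (hasDerivAt_flexMove v).continuousAt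
  have : ∀ ρ σ τ, ∀ᶠ t in 𝓝 (0 : ℝ), 0 < sg ρ * sg σ * sg τ *
      det3 (flexMove t (0, ρ)) (flexMove t (1, σ)) (flexMove t (2, τ)) := by
    intro ρ σ τ
    have hcont : ContinuousAt (fun t => sg ρ * sg σ * sg τ *
        det3 (flexMove t (0, ρ)) (flexMove t (1, σ)) (flexMove t (2, τ))) 0 := by
      simp only [det3]
      have := hc (0, ρ)
      have := hc (1, σ)
      have := hc (2, τ)
      fun_prop
    refine hcont.eventually (lt_mem_nhds ?_)
    simp only [flexMove_zero, octa_zero, octa_one]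
    cases ρ <;> cases σ <;> cases τ <;> norm_num [det3_vec, octa_two_true, octa_two_false]
  simp only [← eventually_all] at this
  filter_upwards [this] with t ht
  exact ⟨fun σ => by simp [flexMove, flex_three, octa_three], mink_flexMove t, ht⟩

theorem isStar_octa : IsStar octa := by
  have := eventually_isStar_flexMove.self_of_nhds
  rwa [funext flexMove_zero] at this

/-! ### The dihedral angles of the octahedron -/

/-- The numerator of the cosine of the dihedral angle, in terms of the Gram matrix. -/
theorem mink_orthTo_direction {a b : E4} (ha : mink a a = -1) (hb : mink b b = -1) (c d : E4)
    (hab : mink a b ^ 2 - 1 ≠ 0) :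
    mink (orthTo (direction a b) (direction a c)) (orthTo (direction a b) (direction a d)) =
      mink c d + mink a c * mink a d - (mink b c + mink a b * mink a c) *
        (mink b d + mink a b * mink a d) / (mink a b ^ 2 - 1) := by
  rw [orthTo_direction ha hb hab, orthTo_direction ha hb hab]
  simp only [mink_sub_left, mink_sub_right, mink_smul_left, mink_smul_right, ha, hb,
    mink_comm c a, mink_comm c b, mink_comm b a]
  field_simp
  ring

/-- At every edge of the octahedron, the dihedral angles of the two tetrahedra around it are both
acute or both obtuse. -/
theorem acute_or_obtuse {i j k : Fin 4} (h : ({i, j, k, 3} : Finset (Fin 4)) = Finset.univ)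
    (σ τ : Bool) :
    (∀ ρ, 0 < mink (orthTo (direction (octa (i, σ)) (octa (j, τ)))
        (direction (octa (i, σ)) (octa (k, ρ))))
      (orthTo (direction (octa (i, σ)) (octa (j, τ))) (direction (octa (i, σ)) origin))) ∨
    (∀ ρ, mink (orthTo (direction (octa (i, σ)) (octa (j, τ)))
        (direction (octa (i, σ)) (octa (k, ρ))))
      (orthTo (direction (octa (i, σ)) (octa (j, τ))) (direction (octa (i, σ)) origin)) < 0) := by
  have hne := quad_eq_univ.1 h
  have hne' : ∀ σ τ, mink (octa (i, σ)) (octa (j, τ)) ^ 2 - 1 ≠ 0 := by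
    intro σ τ
    have := one_lt_mink_edge (v := (i, σ)) (w := (j, τ)) hne.1 hne.2.2.1 hne.2.2.2.2.1
    nlinarith
  simp only [mink_orthTo_direction (mink_octa _) (mink_octa _) _ _ (hne' _ _), Bool.forall_bool]
  fin_cases i <;> fin_cases j <;> fin_cases k <;> first
    | (exfalso; revert hne; decide)
    | (cases σ <;> cases τ <;>
        norm_num [octa, origin, mink_vec])

theorem sum_dihedralAngle_ne_pi {i j k : Fin 4}
    (h : ({i, j, k, 3} : Finset (Fin 4)) = Finset.univ) (σ τ : Bool) :
    ∑ ρ, dihedralAngle (octa (i, σ)) (octa (j, τ)) (octa (k, ρ)) origin ≠ Real.pi := by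
  have hind : ∀ ρ, LinearIndependent ℝ
      ![octa (i, σ), octa (j, τ), octa (k, ρ), origin] := fun ρ =>
    linearIndependent_octa_quad (a := (i, σ)) (b := (j, τ)) (c := (k, ρ)) (d := (3, true)) h
  rw [Fintype.sum_bool]
  rcases acute_or_obtuse h σ τ with hs | hs
  · have h1 := dihedralAngle_lt_pi_div_two (mink_octa _) (hind true) (hs true)
    have h2 := dihedralAngle_lt_pi_div_two (mink_octa _) (hind false) (hs false)
    exact (by linarith : _ < _).ne
  · have h1 := pi_div_two_lt_dihedralAngle (mink_octa _) (hind true) (hs true)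
    have h2 := pi_div_two_lt_dihedralAngle (mink_octa _) (hind false) (hs false)
    exact (by linarith : _ < _).ne'

/-! ### The double of the octahedron -/

/-- Two copies of the octahedron, each divided into eight tetrahedra by its center, glued along
their boundaries: the boundary complex of the cross-polytope, in which the two centers `± e₃` are
placed at the same point of hyperbolic space. -/
noncomputable def doubleGluing : Gluing Vert where
  tets := crossTets
  card_tets _ hs := (mem_crossTets.1 hs).1
  pos _ v := octa v
  pos_mem _ _ v _ := octa_mem v
  nondegenerate _ hs := linearIndependent_octa hs
  isometric _ _ _ _ _ _ _ _ := rfl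

theorem nonempty_chartedSpace_crossSpace :
    Nonempty (ChartedSpace (EuclideanSpace ℝ (Fin 3)) CrossSpace) :=
  haveI : Nonempty CrossSpace :=
    ⟨CrossSpace.homeoSphere.symm ⟨EuclideanSpace.single 0 1, by simp⟩⟩
  letI : ChartedSpace (Metric.sphere (0 : EuclideanSpace ℝ (Fin 4)) 1) CrossSpace :=
    CrossSpace.homeoSphere.isOpenEmbedding.singletonChartedSpace
  ⟨ChartedSpace.comp (EuclideanSpace ℝ (Fin 3)) (Metric.sphere (0 : EuclideanSpace ℝ (Fin 4)) 1)
    CrossSpace⟩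

/-- The double of the octahedron. -/
noncomputable def double : ConeManifold Vert where
  toGluing := doubleGluing
  manifold := nonempty_chartedSpace_crossSpace

@[simp] theorem double_tets : double.tets = crossTets := rfl
@[simp] theorem double_pos (s : Finset Vert) (v : Vert) : double.pos s v = octa v := rfl

theorem exists_third {i j : Fin 4} (hij : i ≠ j) (hi : i ≠ 3) (hj : j ≠ 3) :
    ∃ k, ({i, j, k, 3} : Finset (Fin 4)) = Finset.univ := by
  revert i j; decide

theorem exists_complement {i : Fin 4} (hi : i ≠ 3) :
    ∃ k l, ({3, i, k, l} : Finset (Fin 4)) = Finset.univ := by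
  revert i; decide

theorem quad_swap (i j k l : Fin 4) : ({i, j, k, l} : Finset (Fin 4)) = {j, i, k, l} :=
  Finset.insert_comm _ _ _

theorem IsStar.sum_dihedralAngle_swap {X : Vert → E4} (hX : IsStar X) {i k l : Fin 4}
    (h : ({3, i, k, l} : Finset (Fin 4)) = Finset.univ) (τ : Bool) :
    ∑ ρ, ∑ υ, dihedralAngle (X (i, τ)) origin (X (k, ρ)) (X (l, υ)) = 2 * Real.pi := by
  rw [← hX.sum_dihedralAngle h τ]
  refine Finset.sum_congr rfl fun ρ _ => Finset.sum_congr rfl fun υ _ => ?_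
  have ho : mink origin origin = -1 := by simp [mink, origin]
  exact dihedralAngle_swap ho (hX.unit _)
    (hX.mink_origin_ne (v := (i, τ)) (quad_eq_univ.1 h).1.symm) _ _

/-- The edges at the two centers are not singular. -/
theorem coneAngle_double_center {a b : Vert} (hab : a.1 ≠ b.1) (h : a.1 = 3 ∨ b.1 = 3) :
    coneAngle crossTets double.pos a b = 2 * Real.pi := by
  obtain ⟨i, σ⟩ := a
  obtain ⟨j, τ⟩ := b
  simp only at hab h
  rcases h with rfl | rfl
  · obtain ⟨k, l, hkl⟩ := exists_complement hab.symm
    rw [coneAngle_crossTets _ hkl]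
    exact isStar_octa.sum_dihedralAngle hkl τ
  · obtain ⟨k, l, hkl⟩ := exists_complement hab
    rw [coneAngle_crossTets _ ((quad_swap _ _ _ _).trans hkl)]
    exact isStar_octa.sum_dihedralAngle_swap hkl σ

/-- The cone angles at the edges of the octahedron are twice its dihedral angles, which differ
from `π`. -/
theorem coneAngle_double_edge {a b : Vert} (hab : a.1 ≠ b.1) (ha : a.1 ≠ 3) (hb : b.1 ≠ 3) :
    coneAngle crossTets double.pos a b ≠ 2 * Real.pi := by
  obtain ⟨i, σ⟩ := a
  obtain ⟨j, τ⟩ := b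
  obtain ⟨k, hk⟩ := exists_third hab ha hb
  rw [coneAngle_crossTets _ hk]
  intro h
  apply sum_dihedralAngle_ne_pi hk σ τ
  simp only [double_pos, octa_three, Finset.sum_const, Finset.card_univ, Fintype.card_bool,
    nsmul_eq_mul, ← Finset.mul_sum] at h
  push_cast at h
  exact mul_left_cancel₀ two_ne_zero h

theorem isSingularEdge_double {a b : Vert} :
    double.IsSingularEdge a b ↔ a.1 ≠ b.1 ∧ a.1 ≠ 3 ∧ b.1 ≠ 3 := by
  constructor
  · rintro ⟨hne, ⟨s, hs, ha, hb⟩, h⟩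
    have hab : a.1 ≠ b.1 := fun h => hne (eq_of_fst_eq hs ha hb h)
    exact ⟨hab, fun h3 => h (coneAngle_double_center hab (Or.inl h3)),
      fun h3 => h (coneAngle_double_center hab (Or.inr h3))⟩
  · rintro ⟨hab, ha, hb⟩
    refine ⟨fun h => hab (by rw [h]), ?_, coneAngle_double_edge hab ha hb⟩
    obtain ⟨k, hk⟩ := exists_third hab ha hb
    exact ⟨{a, b, (k, true), (3, true)}, quad_mem_crossTets.2 hk, by simp, by simp⟩

/-! ### The infinitesimal deformation -/

/-- The copy of the octahedron to which a tetrahedron belongs. -/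
def side (s : Finset Vert) : Bool := decide ((3, true) ∈ s)

theorem side_eq {s : Finset Vert} (hs : s ∈ crossTets) {σ : Bool} (h : (3, σ) ∈ s) :
    side s = σ := by
  cases σ
  · rw [side, decide_eq_false_iff_not]
    intro h'
    simpa using eq_of_fst_eq hs h h' rfl
  · rw [side, decide_eq_true_eq]
    exact h

/-- The deformation that flexes one copy of the octahedron, and the other copy in the opposite
direction. -/
noncomputable def oppositeFlex (s : Finset Vert) (v : Vert) : E4 := sg (side s) • flex v

theorem move_oppositeFlex (t : ℝ) (s : Finset Vert) (v : Vert) :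
    double.move oppositeFlex t s v = flexMove (sg (side s) * t) v := by
  rw [ConeManifold.move, oppositeFlex, smul_smul, mul_comm t]
  rfl

theorem hasDerivAt_sg_mul (σ : Bool) : HasDerivAt (fun t => sg σ * t) (sg σ) 0 := by
  simpa using (hasDerivAt_id (0 : ℝ)).const_mul (sg σ)

/-- The lengths of the edges of the octahedron are constant to the first order. -/
theorem hasDerivAt_hdist_flexMove {v w : Vert} (hv : v.1 ≠ 3) (hw : w.1 ≠ 3)
    (hvw : v = w ∨ v.1 ≠ w.1) :
    HasDerivAt (fun t => hdist (flexMove t v) (flexMove t w)) 0 0 := by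
  rcases hvw with rfl | hvw
  · simp only [hdist, mink_flexMove]
    exact hasDerivAt_const _ _
  · have hm := (hasDerivAt_mink (hasDerivAt_flexMove v) (hasDerivAt_flexMove w)).neg
    simp only [flexMove_zero, mink_flex_edge hvw hv hw, neg_zero] at hm
    have := (Real.hasDerivAt_arcosh (x := -mink (flexMove 0 v) (flexMove 0 w))
      (by simpa using one_lt_mink_edge hvw hv hw)).comp (0 : ℝ) hm
    rw [mul_zero] at this
    exact this

theorem eventually_isStar_sg (σ : Bool) : ∀ᶠ t in 𝓝 (0 : ℝ), IsStar (flexMove (sg σ * t)) := by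
  have h := (hasDerivAt_sg_mul σ).continuousAt.tendsto
  rw [mul_zero] at h
  exact h.eventually eventually_isStar_flexMove

/-- The cone angles at the two centers remain `2π` during the deformation. -/
theorem eventually_coneAngle_center {a b : Vert} (hab : a.1 ≠ b.1) (h : a.1 = 3 ∨ b.1 = 3) :
    ∀ᶠ t in 𝓝 (0 : ℝ), coneAngle crossTets (double.move oppositeFlex t) a b = 2 * Real.pi := by
  obtain ⟨i, σ⟩ := a
  obtain ⟨j, τ⟩ := b
  simp only at hab h
  rcases h with rfl | rfl
  · obtain ⟨k, l, hkl⟩ := exists_complement hab.symm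
    filter_upwards [eventually_isStar_sg σ] with t ht
    rw [coneAngle_crossTets _ hkl, ← ht.sum_dihedralAngle hkl τ]
    refine Finset.sum_congr rfl fun ρ _ => Finset.sum_congr rfl fun υ _ => ?_
    have hs : side {((3 : Fin 4), σ), (j, τ), (k, ρ), (l, υ)} = σ :=
      side_eq (quad_mem_crossTets.2 hkl) (by simp)
    simp only [move_oppositeFlex, hs, ht.center]
  · obtain ⟨k, l, hkl⟩ := exists_complement hab
    have hkl' := (quad_swap _ _ _ _).trans hkl
    filter_upwards [eventually_isStar_sg τ] with t ht
    rw [coneAngle_crossTets _ hkl', ← ht.sum_dihedralAngle_swap hkl σ]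
    refine Finset.sum_congr rfl fun ρ _ => Finset.sum_congr rfl fun υ _ => ?_
    have hs : side {(i, σ), ((3 : Fin 4), τ), (k, ρ), (l, υ)} = τ :=
      side_eq (quad_mem_crossTets.2 hkl') (by simp)
    simp only [move_oppositeFlex, hs, ht.center]

/-- The cone angle at an edge of the octahedron is an even function of time. -/
theorem hasDerivAt_coneAngle_edge {a b : Vert} (hab : a.1 ≠ b.1) (ha : a.1 ≠ 3) (hb : b.1 ≠ 3) :
    HasDerivAt (fun t => coneAngle crossTets (double.move oppositeFlex t) a b) 0 0 := by
  obtain ⟨i, σ⟩ := a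
  obtain ⟨j, τ⟩ := b
  obtain ⟨k, hk⟩ := exists_third hab ha hb
  let θ : ℝ → ℝ := fun t => ∑ ρ, dihedralAngle (flexMove t (i, σ)) (flexMove t (j, τ))
    (flexMove t (k, ρ)) (flexMove t (3, true))
  have hθ : DifferentiableAt ℝ θ 0 := by
    refine DifferentiableAt.fun_sum fun ρ _ => ?_
    have hd : ∀ v, DifferentiableAt ℝ (fun t => flexMove t v) 0 := fun v =>
      (hasDerivAt_flexMove v).differentiableAt
    refine differentiableAt_dihedralAngle (hd _) (hd _) (hd _) (hd _) (mink_flexMove _ _) ?_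
    simp only [flexMove_zero]
    exact linearIndependent_octa_quad (a := (i, σ)) (b := (j, τ)) (c := (k, ρ)) (d := (3, true)) hk
  have heq : (fun t => coneAngle crossTets (double.move oppositeFlex t) (i, σ) (j, τ)) =
      fun t => θ t + θ (-t) := by
    ext t
    rw [coneAngle_crossTets _ hk, Finset.sum_comm]
    have hs : ∀ ρ υ, side {(i, σ), (j, τ), (k, ρ), ((3 : Fin 4), υ)} = υ := fun ρ υ =>
      side_eq (quad_mem_crossTets.2 hk) (by simp)
    simp only [move_oppositeFlex, hs, θ]
    rw [Fintype.sum_bool]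
    simp only [sg_true, sg_false, one_mul, neg_one_mul]
    rfl
  rw [heq]
  have h1 := hθ.hasDerivAt
  have h2 : HasDerivAt (fun t => θ (-t)) (-deriv θ 0) 0 := by
    have h0 : HasDerivAt θ (deriv θ 0) (-0) := by rwa [neg_zero]
    exact (h0.scomp (0 : ℝ) (hasDerivAt_neg (0 : ℝ))).congr_deriv (by simp)
  exact (h1.add h2).congr_deriv (by simp)

theorem isInfinitesimalDeformation_oppositeFlex :
    double.IsInfinitesimalDeformation oppositeFlex where
  tangent s _ v _ := by
    change mink (octa v) (sg (side s) • flex v) = 0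
    rw [mink_smul_right, mink_octa_flex, mul_zero]
  isometric s hs s' hs' v hv w hw := by
    rw [Finset.mem_inter] at hv hw
    simp only [move_oppositeFlex]
    by_cases hside : side s = side s'
    · simp only [hside, sub_self]
      exact hasDerivAt_const _ _
    · have h3 : ∀ u, u ∈ s → u ∈ s' → u.1 ≠ 3 := by
        rintro ⟨i, σ⟩ h h' (rfl : i = 3)
        exact hside ((side_eq hs h).trans (side_eq hs' h').symm)
      have hvw : v = w ∨ v.1 ≠ w.1 := by
        by_cases h : v.1 = w.1
        · exact Or.inl (eq_of_fst_eq hs hv.1 hw.1 h)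
        · exact Or.inr h
      have hl := hasDerivAt_hdist_flexMove (h3 v hv.1 hv.2) (h3 w hw.1 hw.2) hvw
      have hcomp : ∀ σ, HasDerivAt
          (fun t => hdist (flexMove (sg σ * t) v) (flexMove (sg σ * t) w)) 0 0 := by
        intro σ
        have h0 : HasDerivAt (fun t => hdist (flexMove t v) (flexMove t w)) 0 (sg σ * 0) := by
          rwa [mul_zero]
        exact (h0.scomp (0 : ℝ) (hasDerivAt_sg_mul σ)).congr_deriv (by simp)
      exact ((hcomp (side s)).sub (hcomp (side s'))).congr_deriv (by simp)
  angles a b := by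
    rw [double_tets]
    by_cases hab : a.1 = b.1
    · simp only [coneAngle_of_fst_eq _ hab]
      exact hasDerivAt_const _ _
    · by_cases h : a.1 = 3 ∨ b.1 = 3
      · exact (hasDerivAt_const _ _).congr_of_eventuallyEq (eventually_coneAngle_center hab h)
      · rw [not_or] at h
        exact hasDerivAt_coneAngle_edge hab h.1 h.2

/-! ### Non-triviality of the deformation -/

theorem IsKilling.mink_self {κ : E4 →ₗ[ℝ] E4} (hκ : IsKilling κ) (x : E4) :
    mink (κ x) x = 0 := by
  have := hκ x x
  rw [mink_comm x] at this
  linarith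

/-- Vertices of the octahedron lie on singular edges of different directions and hence do not move
under a trivial deformation. -/
theorem killing_eq_oppositeFlex {κ : E4 →ₗ[ℝ] E4} (hκ : IsKilling κ) {w : Vert → E4}
    {s : Finset Vert} (hs : s ∈ crossTets) {u v v' z : Vert} (hsq : s = {u, v, v', z})
    (hz : z.1 = 3) (hq : oppositeFlex s u = κ (octa u) + w u)
    (hw : ∀ x ∈ s, double.IsSingularEdge u x →
      w u ∈ Submodule.span ℝ {octa u, octa x}) :
    κ (octa u) = oppositeFlex s u := by
  subst hsq
  have hquad := quad_mem_crossTets.1 hs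
  have hne := quad_eq_univ.1 hquad
  rw [hz] at hne
  have hind : LinearIndependent ℝ ![octa u, octa v, octa v'] := by
    have := (linearIndependent_octa_quad hquad).comp (Fin.castSucc : Fin 3 → Fin 4)
      (Fin.castSucc_injective 3)
    convert this using 1
    ext1 i
    fin_cases i <;> rfl
  have hw0 : w u = 0 := by
    refine eq_zero_of_mem_span_pair hind (mink_octa u) ?_
      (hw v (by simp) (isSingularEdge_double.2 ⟨hne.1, hne.2.2.1, hne.2.2.2.2.1⟩))
      (hw v' (by simp) (isSingularEdge_double.2 ⟨hne.2.1, hne.2.2.1, hne.2.2.2.2.2⟩))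
    rw [← sub_eq_iff_eq_add'.2 hq, mink_sub_left, hκ.mink_self, mink_comm, oppositeFlex,
      mink_smul_right, mink_octa_flex]
    ring
  rw [hq, hw0, add_zero]

/-- Consider the two tetrahedra `A₊B₊C₊N` and `A₋B₊C₊N` of the first copy, `N` being its center. If
the deformation were trivial, their Killing fields would agree on the common face, hence
everywhere; but the flex changes the distance between `A₊` and `A₋` to the first order. -/
theorem not_isTrivialDeformation_oppositeFlex : ¬ double.IsTrivialDeformation oppositeFlex := by
  rintro ⟨κ, w, hκ, hq, hglue, hsing⟩
  let s : Bool → Finset Vert := fun σ => {(0, σ), (1, true), (2, true), (3, true)}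
  have hs : ∀ σ, s σ ∈ crossTets := fun σ => quad_mem_crossTets.2 (by dsimp only; decide)
  have hside : ∀ σ, side (s σ) = true := fun σ => side_eq (hs σ) (by simp [s])
  have hA : ∀ σ, κ (s σ) (octa (0, σ)) = flex (0, σ) := by
    intro σ
    rw [killing_eq_oppositeFlex (w := w (s σ)) (hκ _ (hs σ)) (hs σ) (u := (0, σ)) (v := (1, true))
      (v' := (2, true)) (z := (3, true)) rfl rfl (hq _ (hs σ) _ (by simp [s]))
      (fun x hx => hsing _ (hs σ) _ (by simp [s]) x hx), oppositeFlex, hside]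
    simp
  have hB : ∀ σ, κ (s σ) (octa (1, true)) = flex (1, true) := by
    intro σ
    have hperm : s σ = {(1, true), (0, σ), (2, true), (3, true)} := Finset.insert_comm _ _ _
    rw [killing_eq_oppositeFlex (w := w (s σ)) (hκ _ (hs σ)) (hs σ) (u := (1, true)) (v := (0, σ))
      (v' := (2, true)) (z := (3, true)) hperm rfl (hq _ (hs σ) _ (by simp [s]))
      (fun x hx => hsing _ (hs σ) _ (by simp [s]) x hx), oppositeFlex, hside]
    simp
  have hC : ∀ σ, κ (s σ) (octa (2, true)) = flex (2, true) := by
    intro σ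
    have hperm : s σ = {(2, true), (0, σ), (1, true), (3, true)} := by
      ext x; simp only [s, Finset.mem_insert, Finset.mem_singleton]; tauto
    rw [killing_eq_oppositeFlex (w := w (s σ)) (hκ _ (hs σ)) (hs σ) (u := (2, true)) (v := (0, σ))
      (v' := (1, true)) (z := (3, true)) hperm rfl (hq _ (hs σ) _ (by simp [s]))
      (fun x hx => hsing _ (hs σ) _ (by simp [s]) x hx), oppositeFlex, hside]
    simp
  -- the two tetrahedra lie in the same copy of the octahedron, where they are already in position
  have htrans : double.IsTransition (s true) (s false) LinearMap.id := by
    refine ⟨fun _ _ => rfl, fun _ _ => rfl, ![0, 0, 0, -1], ?_, ?_, ?_⟩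
    · intro v hv
      have hv' : v = (1, true) ∨ v = (2, true) ∨ v = (3, true) := by
        revert v; decide
      rcases hv' with rfl | rfl | rfl <;>
        simp [octa_one, octa_two_true, octa_three, origin, mink_vec]
    · intro v hv
      have hv' : v = (0, true) := by revert v; decide
      subst hv'
      simp [octa_zero, mink_vec]
    · intro v hv
      have hv' : v = (0, false) := by revert v; decide
      subst hv'
      simp [octa_zero, mink_vec]
  have hN : κ (s true) (octa (3, true)) = κ (s false) (octa (3, true)) := by
    have h0 := hglue _ (hs true) _ (hs false) (by decide) _ htrans (3, true) (by decide)
    have h1 := hq _ (hs true) (3, true) (by simp [s])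
    have h2 := hq _ (hs false) (3, true) (by simp [s])
    simp only [oppositeFlex, flex_three, smul_zero, double_pos, LinearMap.id_apply] at h0 h1 h2
    rw [h0] at h1
    exact add_right_cancel (h1.symm.trans h2)
  have hind : LinearIndependent ℝ
      ![octa (0, false), octa (1, true), octa (2, true), octa (3, true)] :=
    linearIndependent_octa_quad (by decide)
  have hδ := ((hκ _ (hs true)).sub (hκ _ (hs false))).eq_zero_of_three hind (by
    intro i hi
    fin_cases i
    · exact absurd rfl hi
    · simp [LinearMap.sub_apply, hB]
    · simp [LinearMap.sub_apply, hC]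
    · simp [LinearMap.sub_apply, hN])
  have hA' : κ (s true) (octa (0, false)) = flex (0, false) := by
    rw [← hA false]
    exact sub_eq_zero.1 hδ
  have hcontra := hκ _ (hs true) (octa (0, true)) (octa (0, false))
  rw [hA true, hA', flex_zero, flex_zero, octa_zero, octa_zero, mink_vec, mink_vec] at hcontra
  norm_num at hcontra

end HypCone

theorem theoremA :
    ∃ (V : Type) (_ : Fintype V) (_ : DecidableEq V) (M : HypCone.ConeManifold V),
      CompactSpace M.carrier ∧
      (∃ h : M.carrier ≃ₜ Metric.sphere (0 : EuclideanSpace ℝ (Fin 4)) 1,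
        ∀ x : M.carrier, x ∈ M.singularLocus ↔
          ∃ r : ℝ, 0 < r ∧ r • (h x : EuclideanSpace ℝ (Fin 4)) ∈ HypCone.octahedronSkeleton) ∧
      M.InfinitesimallyFlexible := by
  refine ⟨HypCone.Vert, inferInstance, inferInstance, HypCone.double,
    HypCone.CrossSpace.homeoSphere.symm.compactSpace,
    ⟨HypCone.CrossSpace.homeoSphere, fun x => ?_⟩,
    HypCone.oppositeFlex, HypCone.isInfinitesimalDeformation_oppositeFlex,
    HypCone.not_isTrivialDeformation_oppositeFlex⟩
  refine Iff.trans ?_ (HypCone.CrossSpace.mem_skeleton_iff x).symm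
  exact exists_congr fun a => exists_congr fun b =>
    and_congr_left fun _ => HypCone.isSingularEdge_double
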